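/- Let $[N]=\{1,\dots,N\}$. Consider a pair of (jointly distributed, possibly correlated) random variables $C\in\{\pm1\}^{N\times\ell}$, with entries $c_i^j$ (the row $i$ is the codeword of user $i$), and $\mathrm{Trace}:\{\pm1\}^\ell\to 2^{[N]}$. Call $a\in\{\pm1\}^\ell$ \emph{$\beta$-consistent} with $C$ if $|\{j\in[\ell] : \nexists\, i\in[N],\ a^j=c_i^j\}|\le\beta\ell$. For $S\subseteq[N]$ let $C_S$ be the rows of $C$ given by $S$. The pair $(C,\mathrm{Trace})$ is an \emph{$n$-collusion-resilient (non-interactive) fingerprinting code of length $\ell$ for $N$ users, robust to a $\beta$ fraction of errors, with failure probability $\varepsilon$ and false accusation probability $\delta$}, if for every $S\subseteq[N]$ with $|S|=n$ and every (randomized) adversary $P:\{\pm1\}^{n\times\ell}\to\{\pm1\}^\ell$, writing $a=P(C_S)$, $$\Pr\big[\,a\text{ is }\beta\text{-consistent with }C\ \wedge\ \mathrm{Trace}(a)=\emptyset\,\big]\le\varepsilon \qquad\text{and}\qquad \Pr\big[\,|\mathrm{Trace}(a)\setminus S|>\delta(N-n)\,\big]\le\varepsilon ,$$ where the probability is over $(C,\mathrm{Trace})$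 and the independent coins of $P$. \textbf{Theorem (Existence of Non-Interactive Fingerprinting Codes).} There are absolute constants $K,c_1,c_2>0$ such that for all integers $1\le n\le N$ and all reals $0\le\beta<1/2$ and $0<\delta\le1$ there is an $n$-collusion-resilient (non-interactive) fingerprinting code for $N$ users, robust to a $\beta$ fraction of errors, with false accusation probability $\delta$, of length $$\ell\le K\cdot\frac{n^2\log(1/\delta)}{(\frac12-\beta)^4},$$ and with failure probability $$\varepsilon\le\min\big\{\delta(N-n),\,2^{-c_1\delta(N-n)}\big\}+\delta^{\,c_2(\frac12-\beta)n}.$$ Moreover, this code accuses a colluder whenever the pirate word is $\beta$-consistent, except with probability at most $\varepsilon$: for every such $S$ and $P$, $$\Pr\big[\,a\text{ is }\beta\text{-consistent with }C\ \wedge\ \mathrm{Trace}(a)\cap S=\emptyset\,\big]\le\varepsilon .$$ -/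

import Mathlib

namespace Fingerprinting

/-- A codebook `C ∈ {±1}^{N × ℓ}`: row `i` is the codeword of user `i`.
The alphabet `{±1}` is the unit group `ℤˣ`. -/
abbrev Codebook (N ℓ : ℕ) : Type := Matrix (Fin N) (Fin ℓ) ℤˣ

/-- A tracing function `{±1}^ℓ → 2^{[N]}`. -/
abbrev Tracer (N ℓ : ℕ) : Type := (Fin ℓ → ℤˣ) → Finset (Fin N)

/-- The joint distribution of a pair of (possibly correlated) random variables `(C, Trace)`.
Both take values in finite sets, so the joint law is a probability mass function. -/
abbrev Scheme (N ℓ : ℕ) : Type := PMF (Codebook N ℓ × Tracer N ℓ)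

/-- The codewords of the coalition `S`: the rows of `C` given by `S`. -/
def restrict {N ℓ : ℕ} (C : Codebook N ℓ) (S : Finset (Fin N)) : Matrix S (Fin ℓ) ℤˣ :=
  C.submatrix Subtype.val id

/-- A randomized adversary for the coalition `S`: it sees only the codewords of `S` and outputs
a random pirate word. -/
abbrev Adversary {N : ℕ} (ℓ : ℕ) (S : Finset (Fin N)) : Type :=
  Matrix S (Fin ℓ) ℤˣ → PMF (Fin ℓ → ℤˣ)

/-- The joint law of `(C, Trace, a)`, where `a` is the pirate word output on the rows of `C`
given by `S`, with coins of the adversary that are independent of `(C, Trace)`. -/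
noncomputable def game {N ℓ : ℕ} (F : Scheme N ℓ) (S : Finset (Fin N)) (P : Adversary ℓ S) :
    PMF (Codebook N ℓ × Tracer N ℓ × (Fin ℓ → ℤˣ)) :=
  F.bind fun x => (P (restrict x.1 S)).map fun a => (x.1, x.2, a)

/-- The probability of an event under a probability mass function. -/
noncomputable def prob {α : Type} (p : PMF α) (E : Set α) : ℝ := (p.toOuterMeasure E).toReal

/-- The number of positions at which `a` agrees with the codeword of no user. -/
noncomputable def errors {N ℓ : ℕ} (C : Codebook N ℓ) (a : Fin ℓ → ℤˣ) : ℕ :=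
  Set.ncard {j : Fin ℓ | ¬ ∃ i : Fin N, a j = C i j}

/-- The pirate word `a` is `β`-consistent with the codebook `C`. -/
def Consistent {N ℓ : ℕ} (β : ℝ) (C : Codebook N ℓ) (a : Fin ℓ → ℤˣ) : Prop :=
  (errors C a : ℝ) ≤ β * ℓ

/-- `F` is an `n`-collusion-resilient (non-interactive) fingerprinting code of length `ℓ` for `N`
users, robust to a `β` fraction of errors, with failure probability `ε` and false accusation
probability `δ`. -/
def IsFingerprintingCode (n : ℕ) {N ℓ : ℕ} (β ε δ : ℝ) (F : Scheme N ℓ) : Prop :=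
  ∀ S : Finset (Fin N), S.card = n → ∀ P : Adversary ℓ S,
    prob (game F S P) {ω | Consistent β ω.1 ω.2.2 ∧ ω.2.1 ω.2.2 = ∅} ≤ ε ∧
    prob (game F S P) {ω | δ * ((N : ℝ) - n) < ((ω.2.1 ω.2.2 \ S).card : ℝ)} ≤ ε

/-- Against every coalition `S` of `n` users, the probability that the pirate word is
`β`-consistent and yet no member of `S` is accused is at most `ε`. -/
def TracesColluder (n : ℕ) {N ℓ : ℕ} (β ε : ℝ) (F : Scheme N ℓ) : Prop :=
  ∀ S : Finset (Fin N), S.card = n → ∀ P : Adversary ℓ S,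
    prob (game F S P) {ω | Consistent β ω.1 ω.2.2 ∧ ω.2.1 ω.2.2 ∩ S = ∅} ≤ ε

end Fingerprinting

namespace Fingerprinting

open Finset
open scoped Classical

/-! The code is a variant of Tardos' code. Write γ = 1/2 - β. Columns are independent. With
probability γ a column is biased: a secret parameter u is drawn from a grid in [η, 1 - η], and the
users get independent bits equal to 1 with probability u²(3 - 2u). Otherwise the column is constant,
with a uniform sign. A user is accused when his score exceeds a threshold σ; the score sums, over
biased columns, the pirate's sign times the logarithmic u-derivative of the probability of the
user's bit.

Innocent users: given the secrets and the pirate word, the score is a sum of independent centred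
terms of variance at most 12, so an exponential moment bounds each accusation (`innocent_bound`) and
independence bounds the number of them (`RowModel.tail_le`).

Coalition: let f be a rule producing the pirate's bit from the coalition's column. The correlation
of f with the coalition's total score is the derivative in u of the mean of f
(`hasDerivAt_colMean`), so its average over the grid is nearly proportional to a difference of end
values (`eventually_riemann_sum_ge`). That difference is about 2, less 2 for each of the two
constant columns on which f is wrong (`colMean_ge`). But such mistakes are errors at the constant
columns of the code, which form a fraction about 1/2 + β > 2β of all columns; the error budget βℓ
covers fewer than half of them, so a positive score remains. `column_bound` makes this quantitative
by a joint exponential moment of score and errors, in which the two effects of a mistake cancel.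

An adversary seeing all columns does no better than a columnwise rule (`sum_columns_le`), so the
column bounds multiply. If no colluder is accused, the total score is at most nσ, which is then
unlikely (`colluder_bound`). For δ > 1/2, random accusations with an empty code suffice. -/

theorem sum_pi_prod {ι κ : Type} [Fintype ι] [DecidableEq ι] [Fintype κ] (f : ι → κ → ℝ) :
    ∑ x : ι → κ, ∏ i, f i (x i) = ∏ i, ∑ k, f i k := by
  rw [Finset.prod_univ_sum, Fintype.piFinset_univ]

theorem piEquiv_symm_mem {R : Type} {N : ℕ} (S : Finset (Fin N)) (x : S → R)
    (y : {i // i ∉ S} → R) (i : S) :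
    (Equiv.piEquivPiSubtypeProd (· ∈ S) fun _ => R).symm (x, y) i = x i := by
  simp [Equiv.piEquivPiSubtypeProd]

theorem piEquiv_symm_not_mem {R : Type} {N : ℕ} (S : Finset (Fin N)) (x : S → R)
    (y : {i // i ∉ S} → R) (i : {i // i ∉ S}) :
    (Equiv.piEquivPiSubtypeProd (· ∈ S) fun _ => R).symm (x, y) i = y i := by
  simp [Equiv.piEquivPiSubtypeProd, i.2]

/-! ### Probabilities under finitely supported laws as real sums -/

/-- The probability mass function with given real weights. -/
noncomputable def pmfOfWeights {α : Type} [Fintype α] (w : α → ℝ) (h0 : ∀ x, 0 ≤ w x)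
    (h1 : ∑ x, w x = 1) : PMF α :=
  PMF.ofFintype (fun x => ENNReal.ofReal (w x))
    (by rw [← ENNReal.ofReal_sum_of_nonneg (fun x _ => h0 x), h1, ENNReal.ofReal_one])

theorem toReal_pmfOfWeights {α : Type} [Fintype α] (w : α → ℝ) (h0 : ∀ x, 0 ≤ w x)
    (h1 : ∑ x, w x = 1) (x : α) : (pmfOfWeights w h0 h1 x).toReal = w x := by
  simp [pmfOfWeights, h0 x]

theorem sum_toReal {α : Type} [Fintype α] (p : PMF α) : ∑ x, (p x).toReal = 1 := by
  rw [← ENNReal.toReal_sum (fun x _ => p.apply_ne_top x), ← tsum_fintype (L := .unconditional _),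
    p.tsum_coe, ENNReal.toReal_one]

theorem prob_eq_sum {α : Type} [Fintype α] (p : PMF α) (E : Set α) :
    prob p E = ∑ x, (p x).toReal * if x ∈ E then 1 else 0 := by
  rw [prob, PMF.toOuterMeasure_apply_fintype, ENNReal.toReal_sum]
  · refine sum_congr rfl fun x _ => ?_
    by_cases h : x ∈ E <;> simp [h]
  · intro x _
    by_cases h : x ∈ E <;> simp [h, p.apply_ne_top x]

theorem prob_bind {α β : Type} [Fintype α] (p : PMF α) (f : α → PMF β) (E : Set β) :
    prob (p.bind f) E = ∑ x, (p x).toReal * prob (f x) E := by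
  rw [prob, PMF.toOuterMeasure_bind_apply, tsum_fintype, ENNReal.toReal_sum]
  · simp [prob, ENNReal.toReal_mul]
  · intro x _
    refine ENNReal.mul_ne_top (p.apply_ne_top x) (ne_top_of_le_ne_top ENNReal.one_ne_top ?_)
    exact (PMF.toOuterMeasure_mono _ (Set.subset_univ _)).trans
      ((PMF.toOuterMeasure_apply_eq_one_iff (f x) Set.univ).2 (Set.subset_univ _)).le

theorem prob_map {α β : Type} (p : PMF α) (g : α → β) (E : Set β) :
    prob (p.map g) E = prob p (g ⁻¹' E) := by
  rw [prob, prob, PMF.toOuterMeasure_map_apply]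

/-! ### Schemes whose rows are independent and identically distributed given a secret -/

/-- A secret with law `μ`, and for each secret `θ` a law `ρ θ` on the data of one user. -/
structure RowModel (Θ R : Type) [Fintype Θ] [Fintype R] where
  μ : Θ → ℝ
  ρ : Θ → R → ℝ
  μ_nonneg : ∀ θ, 0 ≤ μ θ
  ρ_nonneg : ∀ θ r, 0 ≤ ρ θ r
  μ_sum : ∑ θ, μ θ = 1
  ρ_sum : ∀ θ, ∑ r, ρ θ r = 1

namespace RowModel

variable {Θ R : Type} [Fintype Θ] [Fintype R] (D : RowModel Θ R) {N ℓ : ℕ}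

theorem sum_prod_ρ (ι : Type) [Fintype ι] [DecidableEq ι] (θ : Θ) :
    ∑ r : ι → R, ∏ i, D.ρ θ (r i) = 1 := by
  rw [sum_pi_prod fun _ : ι => D.ρ θ]
  simp [D.ρ_sum]

/-- The joint law of the secret and of the data of the `N` users. -/
noncomputable def law (N : ℕ) : PMF (Θ × (Fin N → R)) :=
  pmfOfWeights (fun ω => D.μ ω.1 * ∏ i, D.ρ ω.1 (ω.2 i))
    (fun ω => mul_nonneg (D.μ_nonneg _) (prod_nonneg fun i _ => D.ρ_nonneg _ _))
    (by simp only [Fintype.sum_prod_type, ← mul_sum, D.sum_prod_ρ, mul_one, D.μ_sum])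

/-- The scheme in which `row r` is the codeword of a user with data `r`, and such a user is accused
when `A θ r a` holds. -/
noncomputable def scheme (row : R → Fin ℓ → ℤˣ) (A : Θ → R → (Fin ℓ → ℤˣ) → Prop) (N : ℕ) :
    Scheme N ℓ :=
  (D.law N).map fun ω => (fun i => row (ω.2 i), fun a => univ.filter fun i => A ω.1 (ω.2 i) a)

variable (row : R → Fin ℓ → ℤˣ) (A : Θ → R → (Fin ℓ → ℤˣ) → Prop)

theorem prob_game_scheme (S : Finset (Fin N)) (P : Adversary ℓ S)
    (E : Set (Codebook N ℓ × Tracer N ℓ × (Fin ℓ → ℤˣ))) :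
    prob (game (D.scheme row A N) S P) E =
      ∑ θ, D.μ θ * ∑ r : Fin N → R, (∏ i, D.ρ θ (r i)) *
        ∑ a, (P (fun i : S => row (r i)) a).toReal *
          if ((fun i => row (r i), fun a => univ.filter fun i => A θ (r i) a, a) :
            Codebook N ℓ × Tracer N ℓ × (Fin ℓ → ℤˣ)) ∈ E then 1 else 0 := by
  rw [game, scheme, PMF.bind_map, prob_bind, Fintype.sum_prod_type]
  refine sum_congr rfl fun θ _ => ?_
  rw [mul_sum]
  refine sum_congr rfl fun r _ => ?_
  rw [law, toReal_pmfOfWeights, mul_assoc]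
  congr 2
  simp only [Function.comp_apply]
  rw [prob_map, prob_eq_sum]
  rfl

/-- Splitting the users into a coalition and its complement. -/
theorem sum_split (S : Finset (Fin N)) (θ : Θ) (h : (Fin N → R) → ℝ) :
    ∑ r : Fin N → R, (∏ i, D.ρ θ (r i)) * h r =
      ∑ x : S → R, (∏ i, D.ρ θ (x i)) * ∑ y : {i // i ∉ S} → R, (∏ i, D.ρ θ (y i)) *
        h ((Equiv.piEquivPiSubtypeProd (· ∈ S) fun _ => R).symm (x, y)) := by
  rw [← (Equiv.piEquivPiSubtypeProd (· ∈ S) fun _ => R).symm.sum_comp, Fintype.sum_prod_type]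
  refine sum_congr rfl fun x _ => ?_
  rw [mul_sum]
  refine sum_congr rfl fun y _ => ?_
  rw [← mul_assoc]
  congr 1
  rw [← Fintype.prod_subtype_mul_prod_subtype (· ∈ S)]
  congr 1
  · refine prod_congr (by ext; simp) fun i _ => ?_
    simp [Equiv.piEquivPiSubtypeProd, i.2]
  · refine prod_congr (by ext; simp) fun i _ => ?_
    simp [Equiv.piEquivPiSubtypeProd, i.2]

/-- An event that only depends on the secret, the data of the coalition and the pirate word has a
probability that can be computed without the other users. -/
theorem prob_game_le_coalition (S : Finset (Fin N)) (P : Adversary ℓ S)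
    (E : Set (Codebook N ℓ × Tracer N ℓ × (Fin ℓ → ℤˣ)))
    (E' : Θ → (S → R) → (Fin ℓ → ℤˣ) → Prop) [∀ θ x a, Decidable (E' θ x a)]
    (hE : ∀ θ (r : Fin N → R) a, (∀ i, D.ρ θ (r i) ≠ 0) →
      ((fun i => row (r i), fun a => univ.filter fun i => A θ (r i) a, a) :
            Codebook N ℓ × Tracer N ℓ × (Fin ℓ → ℤˣ)) ∈ E → E' θ (fun i => r i) a) :
    prob (game (D.scheme row A N) S P) E ≤
      ∑ θ, D.μ θ * ∑ x : S → R, (∏ i, D.ρ θ (x i)) *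
        ∑ a, (P (fun i => row (x i)) a).toReal * if E' θ x a then 1 else 0 := by
  rw [prob_game_scheme]
  refine sum_le_sum fun θ _ => mul_le_mul_of_nonneg_left ?_ (D.μ_nonneg θ)
  calc _ ≤ ∑ r : Fin N → R, (∏ i, D.ρ θ (r i)) *
        ∑ a, (P (fun i : S => row (r i)) a).toReal *
          if E' θ (fun i => r i) a then 1 else 0 := by
        refine sum_le_sum fun r _ => ?_
        by_cases h0 : ∏ i, D.ρ θ (r i) = 0
        · simp [h0]
        refine mul_le_mul_of_nonneg_left ?_ (prod_nonneg fun i _ => D.ρ_nonneg _ _)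
        refine sum_le_sum fun a _ => mul_le_mul_of_nonneg_left ?_ ENNReal.toReal_nonneg
        have h1 : ∀ i, D.ρ θ (r i) ≠ 0 := fun i => (prod_ne_zero_iff.1 h0) i (mem_univ i)
        by_cases h2 : ((fun i => row (r i), fun a => univ.filter fun i => A θ (r i) a, a) :
            Codebook N ℓ × Tracer N ℓ × (Fin ℓ → ℤˣ)) ∈ E
        · simp [h2, hE θ r a h1 h2]
        · rw [if_neg h2]; split_ifs <;> norm_num
    _ = _ := by
        rw [sum_split D S θ]
        refine sum_congr rfl fun x _ => ?_
        congr 1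
        simp only [piEquiv_symm_mem]
        rw [← sum_mul, sum_prod_ρ, one_mul]

/-- Tail bound for the number of successes among independent trials with success probability at
most `δ / 8`. -/
theorem tail_le (ι : Type) [Fintype ι] [DecidableEq ι] (θ : Θ) (B : R → Prop) (δ : ℝ) (hδ : 0 < δ)
    (hB : ∑ r, D.ρ θ r * (if B r then 1 else 0) ≤ δ / 8) :
    ∑ y : ι → R, (∏ i, D.ρ θ (y i)) *
        (if δ * Fintype.card ι < ((univ.filter fun i => B (y i)).card : ℝ) then (1 : ℝ) else 0) ≤
      min (δ * Fintype.card ι) ((2 : ℝ) ^ (-(1 / 2 * (δ * Fintype.card ι)))) := by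
  have hw : ∀ y : ι → R, 0 ≤ ∏ i, D.ρ θ (y i) := fun y => prod_nonneg fun i _ => D.ρ_nonneg _ _
  have hcard : ∀ y : ι → R, ((univ.filter fun i => B (y i)).card : ℝ) =
      ∑ i, if B (y i) then (1 : ℝ) else 0 := by
    intro y; rw [card_filter]; push_cast; rfl
  have hm : (0 : ℝ) ≤ δ * Fintype.card ι := by positivity
  refine le_min ?_ ?_
  -- Union bound: a count exceeding a nonnegative number is at least 1.
  · calc _ ≤ ∑ y : ι → R, (∏ i, D.ρ θ (y i)) * ∑ i, (if B (y i) then (1 : ℝ) else 0) := by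
          refine sum_le_sum fun y _ => mul_le_mul_of_nonneg_left ?_ (hw y)
          rw [← hcard y]
          split_ifs with h
          · have : 0 < (univ.filter fun i => B (y i)).card := by
              have := hm.trans_lt h
              exact_mod_cast this
            exact_mod_cast this
          · positivity
      _ = ∑ i : ι, ∑ y : ι → R, ∏ k, (D.ρ θ (y k) *
            if k = i then (if B (y k) then (1 : ℝ) else 0) else 1) := by
          rw [sum_comm]
          refine sum_congr rfl fun y _ => ?_
          rw [mul_sum]
          refine sum_congr rfl fun i _ => ?_
          rw [prod_mul_distrib, prod_ite_eq' univ i]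
          simp
      _ ≤ ∑ i : ι, δ / 8 := by
          refine sum_le_sum fun i _ => ?_
          rw [sum_pi_prod fun k r => D.ρ θ r * if k = i then (if B r then (1 : ℝ) else 0) else 1,
            ← mul_prod_erase univ _ (mem_univ i), prod_eq_one, mul_one]
          · simpa using hB
          · intro k hk
            simp [ne_of_mem_erase hk, D.ρ_sum]
      _ ≤ _ := by
          rw [sum_const, nsmul_eq_mul, card_univ]
          nlinarith
  · set m : ℝ := (Fintype.card ι : ℝ)
    calc _ ≤ ∑ y : ι → R, (∏ i, D.ρ θ (y i)) * (Real.exp (-(δ * m)) *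
            ∏ i, Real.exp (if B (y i) then (1 : ℝ) else 0)) := by
          refine sum_le_sum fun y _ => mul_le_mul_of_nonneg_left ?_ (hw y)
          rw [← Real.exp_sum, ← Real.exp_add, ← hcard y]
          split_ifs with h
          · exact Real.one_le_exp (by linarith)
          · positivity
      _ = Real.exp (-(δ * m)) * ∏ i : ι, ∑ r, D.ρ θ r *
            Real.exp (if B r then (1 : ℝ) else 0) := by
          rw [← sum_pi_prod fun (_ : ι) r => D.ρ θ r * Real.exp (if B r then (1 : ℝ) else 0),
            mul_sum]
          refine sum_congr rfl fun y _ => ?_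
          rw [prod_mul_distrib]; ring
      _ ≤ Real.exp (-(δ * m)) * ∏ i : ι, Real.exp (δ / 4) := by
          refine mul_le_mul_of_nonneg_left ?_ (Real.exp_pos _).le
          refine prod_le_prod (fun i _ => sum_nonneg fun r _ =>
            mul_nonneg (D.ρ_nonneg _ _) (Real.exp_pos _).le) fun i _ => ?_
          calc ∑ r, D.ρ θ r * Real.exp (if B r then (1 : ℝ) else 0)
              ≤ ∑ r, (D.ρ θ r + 2 * (D.ρ θ r * if B r then 1 else 0)) := by
                refine sum_le_sum fun r _ => ?_
                have := D.ρ_nonneg θ r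
                split_ifs
                -- The factor 2 dominates e - 1.
                · nlinarith [Real.exp_one_lt_d9]
                · simp
            _ ≤ 1 + δ / 4 := by
                rw [sum_add_distrib, D.ρ_sum, ← mul_sum]; linarith
            _ ≤ Real.exp (δ / 4) := by linarith [Real.add_one_le_exp (δ / 4)]
      _ = Real.exp (-(3 / 4 * (δ * m))) := by
          rw [prod_const, card_univ, ← Real.exp_nat_mul, ← Real.exp_add]
          congr 1; simp only [m]; ring
      _ ≤ _ := by
          rw [Real.rpow_def_of_pos two_pos]
          refine Real.exp_le_exp.2 ?_
          nlinarith [Real.log_two_lt_d9]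

/-- Few innocent users are accused when each is accused with probability at most `δ / 8`, whatever
the secret and the pirate word. -/
theorem prob_false_accusation_le (S : Finset (Fin N)) (P : Adversary ℓ S) (δ : ℝ) (hδ : 0 < δ)
    (hA : ∀ θ a, ∑ r, D.ρ θ r * (if A θ r a then 1 else 0) ≤ δ / 8) :
    prob (game (D.scheme row A N) S P)
        {ω | δ * ((N : ℝ) - S.card) < ((ω.2.1 ω.2.2 \ S).card : ℝ)} ≤
      min (δ * ((N : ℝ) - S.card)) ((2 : ℝ) ^ (-(1 / 2 * (δ * ((N : ℝ) - S.card))))) := by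
  have hm : ((N : ℝ) - S.card) = Fintype.card {i // i ∉ S} := by
    rw [Fintype.card_subtype_compl, Fintype.card_fin, Fintype.card_coe, Nat.cast_sub]
    simpa using card_le_univ S
  rw [prob_game_scheme, hm]
  set b := min (δ * (Fintype.card {i // i ∉ S} : ℝ))
    ((2 : ℝ) ^ (-(1 / 2 * (δ * (Fintype.card {i // i ∉ S} : ℝ)))))
  have hcard : ∀ (θ : Θ) (a : Fin ℓ → ℤˣ) (x : S → R) (y : {i // i ∉ S} → R),
      ((univ.filter fun i => A θ
        ((Equiv.piEquivPiSubtypeProd (· ∈ S) fun _ => R).symm (x, y) i) a) \ S).card =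
      (univ.filter fun i => A θ (y i) a).card := by
    intro θ a x y
    rw [← card_map (Function.Embedding.subtype (· ∉ S))]
    congr 1
    ext i
    simp only [mem_sdiff, mem_filter, mem_univ, true_and, mem_map,
      Function.Embedding.subtype_apply, Subtype.exists, exists_and_right, exists_eq_right]
    constructor
    · rintro ⟨h1, h2⟩
      exact ⟨h2, by rwa [← piEquiv_symm_not_mem S x y ⟨i, h2⟩]⟩
    · rintro ⟨h2, h1⟩
      exact ⟨by rwa [← piEquiv_symm_not_mem S x y ⟨i, h2⟩] at h1, h2⟩
  calc _ ≤ ∑ θ, D.μ θ * b := by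
        refine sum_le_sum fun θ _ => mul_le_mul_of_nonneg_left ?_ (D.μ_nonneg θ)
        rw [sum_split D S θ]
        calc _ ≤ ∑ x : S → R, (∏ i, D.ρ θ (x i)) * b := by
              refine sum_le_sum fun x _ => mul_le_mul_of_nonneg_left ?_
                (prod_nonneg fun i _ => D.ρ_nonneg _ _)
              simp only [piEquiv_symm_mem, Set.mem_ofPred_eq, hcard, mul_sum]
              -- The pirate word depends only on the coalition's data `x`, so it can be fixed before
              -- averaging over the innocent rows.
              rw [sum_comm]
              calc _ ≤ ∑ a, (P (fun i => row (x i)) a).toReal * b := by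
                    refine sum_le_sum fun a _ => ?_
                    refine le_trans (le_of_eq ?_) (mul_le_mul_of_nonneg_left
                      (D.tail_le {i // i ∉ S} θ (fun r => A θ r a) δ hδ (hA θ a))
                      ENNReal.toReal_nonneg)
                    rw [mul_sum]
                    exact sum_congr rfl fun y _ => mul_left_comm _ _ _
                _ = b := by rw [← sum_mul, sum_toReal, one_mul]
          _ = b := by rw [← sum_mul, sum_prod_ρ, one_mul]
    _ = b := by rw [← sum_mul, D.μ_sum, one_mul]

end RowModel

/-! ### Signs as real numbers -/

theorem sum_units (f : ℤˣ → ℝ) : ∑ b, f b = f 1 + f (-1) := by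
  rw [UnitsInt.univ, sum_pair (by decide)]

/-- A unit of `ℤ`, as a real number. -/
noncomputable def sgn (b : ℤˣ) : ℝ := ((b : ℤ) : ℝ)

@[simp] theorem sgn_one : sgn 1 = 1 := by simp [sgn]

@[simp] theorem sgn_neg_one : sgn (-1) = -1 := by simp [sgn]

theorem sgn_eq (b : ℤˣ) : sgn b = 1 ∨ sgn b = -1 := by
  rcases Int.units_eq_one_or b with rfl | rfl <;> simp

theorem abs_sgn (b : ℤˣ) : |sgn b| = 1 := by
  rcases sgn_eq b with h | h <;> simp [h]

/-! ### The family of biased bits and its score function -/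

/-- The law of a bit with bias parameter `u`. -/
noncomputable def bias (u : ℝ) (b : ℤˣ) : ℝ :=
  if b = 1 then u ^ 2 * (3 - 2 * u) else (1 - u) ^ 2 * (1 + 2 * u)

/-- The logarithmic derivative of `bias` in its parameter. -/
noncomputable def biasScore (u : ℝ) (b : ℤˣ) : ℝ :=
  if b = 1 then 6 * (1 - u) / (u * (3 - 2 * u)) else -(6 * u / ((1 - u) * (1 + 2 * u)))

@[simp] theorem bias_one (u : ℝ) : bias u 1 = u ^ 2 * (3 - 2 * u) := if_pos rfl

@[simp] theorem bias_neg_one (u : ℝ) : bias u (-1) = (1 - u) ^ 2 * (1 + 2 * u) :=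
  if_neg (by decide)

@[simp] theorem biasScore_one (u : ℝ) : biasScore u 1 = 6 * (1 - u) / (u * (3 - 2 * u)) :=
  if_pos rfl

@[simp] theorem biasScore_neg_one (u : ℝ) :
    biasScore u (-1) = -(6 * u / ((1 - u) * (1 + 2 * u))) :=
  if_neg (by decide)

theorem bias_nonneg {u : ℝ} (h0 : 0 ≤ u) (h1 : u ≤ 1) (b : ℤˣ) : 0 ≤ bias u b := by
  rcases Int.units_eq_one_or b with rfl | rfl
  · rw [bias_one]; exact mul_nonneg (sq_nonneg _) (by linarith)
  · rw [bias_neg_one]; exact mul_nonneg (sq_nonneg _) (by linarith)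

theorem bias_sum (u : ℝ) : ∑ b, bias u b = 1 := by
  rw [sum_units, bias_one, bias_neg_one]; ring

theorem bias_mul_biasScore {u : ℝ} (h0 : 0 < u) (h1 : u < 1) (b : ℤˣ) :
    bias u b * biasScore u b = sgn b * (6 * u * (1 - u)) := by
  have h2 : 3 - 2 * u ≠ 0 := by linarith
  have h3 : 1 - u ≠ 0 := by linarith
  have h4 : 1 + 2 * u ≠ 0 := by linarith
  rcases Int.units_eq_one_or b with rfl | rfl
  · simp only [bias_one, biasScore_one, sgn_one]
    generalize 3 - 2 * u = v at h2 ⊢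
    field_simp
  · simp only [bias_neg_one, biasScore_neg_one, sgn_neg_one]
    generalize 1 + 2 * u = v at h4 ⊢
    generalize 1 - u = w at h3 ⊢
    field_simp

theorem hasDerivAt_bias {u : ℝ} (h0 : 0 < u) (h1 : u < 1) (b : ℤˣ) :
    HasDerivAt (fun u => bias u b) (bias u b * biasScore u b) u := by
  rw [bias_mul_biasScore h0 h1]
  rcases Int.units_eq_one_or b with rfl | rfl
  · simp only [bias_one]
    have := ((hasDerivAt_id u).pow 2).mul (((hasDerivAt_id u).const_mul 2).const_sub 3)
    exact this.congr_deriv (by simp; ring)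
  · simp only [bias_neg_one]
    have := (((hasDerivAt_id u).const_sub 1).pow 2).mul
      (((hasDerivAt_id u).const_mul 2).const_add 1)
    exact this.congr_deriv (by simp; ring)

theorem bias_score_mean {u : ℝ} (h0 : 0 < u) (h1 : u < 1) :
    ∑ b, bias u b * biasScore u b = 0 := by
  simp only [bias_mul_biasScore h0 h1, sum_units, sgn_one, sgn_neg_one]; ring

/-- The parametrization u²(3 - 2u) is chosen for this: the Fisher information is 36 / (3 + 4u(1 -
u)), bounded up to both ends. -/
theorem bias_score_variance {u : ℝ} (h0 : 0 < u) (h1 : u < 1) :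
    ∑ b, bias u b * biasScore u b ^ 2 ≤ 12 := by
  have h2 : 0 < 3 - 2 * u := by linarith
  have h3 : 0 < 1 - u := by linarith
  have h4 : 0 < 1 + 2 * u := by linarith
  simp only [sq (biasScore _ _), ← mul_assoc, bias_mul_biasScore h0 h1, sum_units, sgn_one,
    sgn_neg_one, biasScore_one, biasScore_neg_one]
  have : 1 * 6 * u * (1 - u) * (6 * (1 - u) / (u * (3 - 2 * u))) +
      -1 * 6 * u * (1 - u) * -(6 * u / ((1 - u) * (1 + 2 * u))) =
      36 / ((3 - 2 * u) * (1 + 2 * u)) := by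
    obtain ⟨v, hv⟩ : ∃ v, v = 3 - 2 * u := ⟨_, rfl⟩
    obtain ⟨w, hw⟩ : ∃ w, w = 1 + 2 * u := ⟨_, rfl⟩
    rw [← hv] at h2 ⊢
    rw [← hw] at h4 ⊢
    field_simp
    rw [hv, hw]
    ring
  rw [this, div_le_iff₀ (by positivity)]
  nlinarith [mul_pos h0 h3]

/-- The score of the rarer bit blows up like 2/u at an end. Hence the cutoff η, and the restriction
of exponential tilts to η/2. -/
theorem abs_biasScore_le {η u : ℝ} (hη : 0 < η) (h0 : η ≤ u) (h1 : u ≤ 1 - η) (b : ℤˣ) :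
    |biasScore u b| * η ≤ 2 := by
  have h2 : 0 < 3 - 2 * u := by linarith
  have h3 : 0 < 1 - u := by linarith
  have h4 : 0 < 1 + 2 * u := by linarith
  have h5 : 0 < u := by linarith
  rcases Int.units_eq_one_or b with rfl | rfl
  · rw [biasScore_one, abs_of_nonneg (by positivity), div_mul_eq_mul_div,
      div_le_iff₀ (by positivity)]
    nlinarith [mul_pos h5 h3]
  · rw [biasScore_neg_one, abs_neg, abs_of_nonneg (by positivity), div_mul_eq_mul_div,
      div_le_iff₀ (by positivity)]
    nlinarith [mul_pos h5 h3]

theorem bias_mgf_le {η u s : ℝ} (hη : 0 < η) (h0 : η ≤ u) (h1 : u ≤ 1 - η)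
    (hs : 2 * |s| ≤ η) :
    ∑ b, bias u b * Real.exp (s * biasScore u b) ≤ Real.exp (12 * s ^ 2) := by
  have hu0 : 0 < u := by linarith
  have hu1 : u < 1 := by linarith
  calc _ ≤ ∑ b, (bias u b + s * (bias u b * biasScore u b) +
        s ^ 2 * (bias u b * biasScore u b ^ 2)) := by
        refine sum_le_sum fun b _ => ?_
        have hx : |s * biasScore u b| ≤ 1 := by
          rw [abs_mul]
          have := abs_biasScore_le hη h0 h1 b
          nlinarith [abs_nonneg s, abs_nonneg (biasScore u b)]
        have := (abs_le.1 (Real.abs_exp_sub_one_sub_id_le hx)).2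
        have hb := bias_nonneg hu0.le hu1.le b
        calc _ ≤ bias u b * (1 + s * biasScore u b + (s * biasScore u b) ^ 2) :=
              mul_le_mul_of_nonneg_left (by linarith) hb
          _ = _ := by ring
    _ ≤ 1 + 12 * s ^ 2 := by
        rw [sum_add_distrib, sum_add_distrib, ← mul_sum, ← mul_sum, bias_sum,
          bias_score_mean hu0 hu1]
        nlinarith [bias_score_variance hu0 hu1, sq_nonneg s]
    _ ≤ _ := by linarith [Real.add_one_le_exp (12 * s ^ 2)]

/-! ### Columns of independent biased bits -/

section Column

variable {I : Type} [Fintype I]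

/-- The law of a column of independent bits. -/
noncomputable def colLaw (u : ℝ) (x : I → ℤˣ) : ℝ := ∏ i, bias u (x i)

theorem colLaw_nonneg {u : ℝ} (h0 : 0 ≤ u) (h1 : u ≤ 1) (x : I → ℤˣ) : 0 ≤ colLaw u x :=
  prod_nonneg fun _ _ => bias_nonneg h0 h1 _

/-- The total score of a column. -/
noncomputable def colScore (u : ℝ) (x : I → ℤˣ) : ℝ := ∑ i, biasScore u (x i)

variable [DecidableEq I]

/-- The expectation of the sign `f` of a column. -/
noncomputable def colMean (f : (I → ℤˣ) → ℤˣ) (u : ℝ) : ℝ := ∑ x, colLaw u x * sgn (f x)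

/-- The correlation of the sign `f` of a column with the total score. -/
noncomputable def colCorr (f : (I → ℤˣ) → ℤˣ) (u : ℝ) : ℝ :=
  ∑ x, colLaw u x * colScore u x * sgn (f x)

theorem colLaw_sum (u : ℝ) : ∑ x : I → ℤˣ, colLaw u x = 1 := by
  simp only [colLaw]
  rw [sum_pi_prod fun _ => bias u]
  simp only [bias_sum, prod_const_one]

theorem hasDerivAt_colLaw {u : ℝ} (h0 : 0 < u) (h1 : u < 1) (x : I → ℤˣ) :
    HasDerivAt (fun u => colLaw u x) (colLaw u x * colScore u x) u := by
  have := HasDerivAt.fun_finsetProd (u := univ) (x := u)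
    (fun i (_ : i ∈ univ) => hasDerivAt_bias h0 h1 (x i))
  refine this.congr_deriv ?_
  rw [colScore, mul_sum]
  refine sum_congr rfl fun i _ => ?_
  rw [colLaw, ← mul_prod_erase univ _ (mem_univ i), smul_eq_mul]
  ring

/-- The fingerprinting identity: the correlation is the derivative of the mean. -/
theorem hasDerivAt_colMean {u : ℝ} (h0 : 0 < u) (h1 : u < 1) (f : (I → ℤˣ) → ℤˣ) :
    HasDerivAt (colMean f) (colCorr f u) u := by
  exact HasDerivAt.fun_sum fun x _ => (hasDerivAt_colLaw h0 h1 x).mul_const _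

theorem continuousOn_colCorr {η : ℝ} (hη : 0 < η) (f : (I → ℤˣ) → ℤˣ) :
    ContinuousOn (colCorr f) (Set.Icc η (1 - η)) := by
  have hb : ∀ b, ContinuousOn (fun u => biasScore u b) (Set.Icc η (1 - η)) := by
    intro b
    rcases Int.units_eq_one_or b with rfl | rfl
    · simp only [biasScore_one]
      refine ContinuousOn.div (by fun_prop) (by fun_prop) fun u hu => ?_
      have h1 : 0 < u := by linarith [hu.1]
      have h2 : 0 < 3 - 2 * u := by linarith [hu.2]
      positivity
    · simp only [biasScore_neg_one]
      refine ContinuousOn.neg (ContinuousOn.div (by fun_prop) (by fun_prop) fun u hu => ?_)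
      have h1 : 0 < 1 - u := by linarith [hu.2]
      have h2 : 0 < 1 + 2 * u := by linarith [hu.1]
      positivity
  refine continuousOn_finsetSum _ fun x _ => ContinuousOn.mul (ContinuousOn.mul ?_ ?_)
    continuousOn_const
  · intro u hu
    exact (hasDerivAt_colLaw (by linarith [hu.1]) (by linarith [hu.2]) x).continuousAt
      |>.continuousWithinAt
  · exact continuousOn_finsetSum _ fun i _ => hb (x i)

/-! ### Averaging the correlation over a grid, and its end values -/

/-- The nodes of an equidistant partition of `[η, 1 - η]`. -/
noncomputable def node (η : ℝ) (M k : ℕ) : ℝ := η + k * ((1 - 2 * η) / M)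

theorem node_mem {η : ℝ} (hη : η ≤ 1 / 4) {M k : ℕ} (hk : k ≤ M) (hM : 0 < M) :
    node η M k ∈ Set.Icc η (1 - η) := by
  have hM' : (0 : ℝ) < M := by exact_mod_cast hM
  have hk' : (k : ℝ) ≤ M := by exact_mod_cast hk
  have h1 : (k : ℝ) * ((1 - 2 * η) / M) ≤ 1 - 2 * η := by
    rw [mul_div_assoc', div_le_iff₀ hM']; nlinarith
  have h2 : 0 ≤ (k : ℝ) * ((1 - 2 * η) / M) :=
    mul_nonneg (by positivity) (div_nonneg (by linarith) hM'.le)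
  exact ⟨by unfold node; linarith, by unfold node; linarith⟩

/-- Left Riemann sums of a derivative. -/
theorem eventually_riemann_sum_ge {G G' : ℝ → ℝ} {η : ℝ} (hη : 0 < η) (hη' : η ≤ 1 / 4)
    (hd : ∀ u ∈ Set.Icc η (1 - η), HasDerivAt G (G' u) u)
    (hc : ContinuousOn G' (Set.Icc η (1 - η))) {e : ℝ} (he : 0 < e) :
    ∀ᶠ M : ℕ in Filter.atTop,
      G (1 - η) - G η - e ≤ (1 - 2 * η) / M * ∑ k : Fin M, G' (node η M k) := by
  have hL : 0 < 1 - 2 * η := by linarith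
  obtain ⟨d, hd0, hd1⟩ := Metric.uniformContinuousOn_iff.1
    (isCompact_Icc.uniformContinuousOn_of_continuous hc) e he
  filter_upwards [Filter.eventually_gt_atTop 0, Filter.eventually_gt_atTop ⌈(1 - 2 * η) / d⌉₊]
    with M hM hM2
  have hM' : (0 : ℝ) < M := by exact_mod_cast hM
  have hh : (1 - 2 * η) / M < d := by
    have : (1 - 2 * η) / d < M := (Nat.le_ceil _).trans_lt (by exact_mod_cast hM2)
    rw [div_lt_iff₀ hd0] at this
    rw [div_lt_iff₀ hM']; linarith
  have hh0 : 0 < (1 - 2 * η) / M := div_pos hL hM'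
  have hstep : ∀ k ∈ range M, G (node η M (k + 1)) - G (node η M k) ≤
      (1 - 2 * η) / M * G' (node η M k) + (1 - 2 * η) / M * e := by
    intro k hk
    have hk := mem_range.1 hk
    have hlt : node η M (k + 1) = node η M k + (1 - 2 * η) / M := by
      simp only [node]; push_cast; ring
    have h1 := node_mem hη' hk.le hM
    have h2 := node_mem hη' (Nat.succ_le_of_lt hk) hM
    have hsub : Set.Icc (node η M k) (node η M (k + 1)) ⊆ Set.Icc η (1 - η) :=
      Set.Icc_subset_Icc h1.1 h2.2
    obtain ⟨ξ, hξ, hs⟩ := exists_hasDerivAt_eq_slope G G'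
      (show node η M k < node η M (k + 1) by linarith)
      (fun u hu => (hd u (hsub hu)).continuousAt.continuousWithinAt)
      (fun u hu => hd u (hsub (Set.Ioo_subset_Icc_self hu)))
    rw [hlt, add_sub_cancel_left, ← hlt, eq_div_iff hh0.ne'] at hs
    have hdist : dist (G' ξ) (G' (node η M k)) < e := by
      refine hd1 ξ (hsub (Set.Ioo_subset_Icc_self hξ)) _ h1 ?_
      rw [Real.dist_eq, abs_of_pos (by linarith [hξ.1])]
      linarith [hξ.2]
    rw [Real.dist_eq] at hdist
    have := (abs_lt.1 hdist).2
    rw [← hs]; nlinarith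
  have hsum := sum_le_sum hstep
  rw [sum_range_sub (fun k => G (node η M k)), sum_add_distrib, ← mul_sum, sum_const, card_range,
    nsmul_eq_mul] at hsum
  have hn0 : node η M 0 = η := by simp [node]
  have hn1 : node η M M = 1 - η := by
    simp only [node]; field_simp; ring
  -- The errors per step add up to `e` times the interval length, which is below 1.
  have he2 : (M : ℝ) * ((1 - 2 * η) / M * e) ≤ e := by
    have : (M : ℝ) * ((1 - 2 * η) / M * e) = (1 - 2 * η) * e := by field_simp
    rw [this]
    nlinarith
  rw [hn0, hn1] at hsum
  rw [Fin.sum_univ_eq_sum_range (fun k => G' (node η M k)) M]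
  linarith

/-- The penalty indicator: the sign `b'` differs from the constant column `b`. -/
noncomputable def wrong (b b' : ℤˣ) : ℝ := if b' = b then 0 else 1

/-- At the ends of the parameter range, the mean of `f` is close to its value at a constant
column. -/
theorem colMean_ge {η u : ℝ} (h0 : 0 ≤ u) (h1 : u ≤ 1) (b : ℤˣ)
    (hη : 3 * η ^ 2 ≤ 1) (hb : 1 - 3 * η ^ 2 ≤ bias u b) (f : (I → ℤˣ) → ℤˣ) :
    1 - 6 * Fintype.card I * η ^ 2 - 2 * wrong b (f fun _ => b) ≤ sgn b * colMean f u := by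
  -- Every column except the constant one is counted as if `f` gave the sign opposite to `b`.
  have hmain : -1 + 2 * (1 - wrong b (f fun _ => b)) * colLaw u (fun _ : I => b) ≤
      sgn b * colMean f u := by
    calc _ = ∑ x : I → ℤˣ, colLaw u x * (-1 + 2 * (1 - wrong b (f fun _ => b)) *
          if x = fun _ => b then 1 else 0) := by
          simp only [mul_add, sum_add_distrib, mul_neg, mul_one, sum_neg_distrib, colLaw_sum,
            mul_ite, mul_zero, sum_ite_eq', mem_univ, if_true]
          ring
      _ ≤ ∑ x : I → ℤˣ, colLaw u x * (sgn b * sgn (f x)) := by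
          refine sum_le_sum fun x _ => mul_le_mul_of_nonneg_left ?_ (colLaw_nonneg h0 h1 x)
          have hge : ∀ b b' : ℤˣ, -1 ≤ sgn b * sgn b' := by
            intro b b'
            rcases sgn_eq b with h | h <;> rcases sgn_eq b' with h' | h' <;>
              simp [h, h']
          by_cases hx : x = fun _ => b
          · subst hx
            by_cases hf : (f fun _ => b) = b
            · rcases sgn_eq b with h | h <;> simp [wrong, hf, h] <;> norm_num
            · simpa [wrong, hf] using hge b _
          · simpa [hx] using hge b _
      _ = _ := by
          rw [colMean, mul_sum]
          exact sum_congr rfl fun x _ => mul_left_comm _ _ _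
  have hpow : 1 - 3 * Fintype.card I * η ^ 2 ≤ colLaw u (fun _ : I => b) := by
    rw [colLaw, prod_const, card_univ]
    calc _ = 1 + (Fintype.card I : ℝ) * (-(3 * η ^ 2)) := by ring
      _ ≤ (1 + -(3 * η ^ 2)) ^ Fintype.card I := one_add_mul_le_pow (by linarith) _
      _ ≤ _ := pow_le_pow_left₀ (by linarith) (by linarith) _
  have hle : colLaw u (fun _ : I => b) ≤ 1 := by
    rw [← colLaw_sum (I := I) u]
    exact single_le_sum (fun x _ => colLaw_nonneg h0 h1 x) (mem_univ _)
  refine le_trans ?_ hmain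
  unfold wrong
  have : 0 ≤ (Fintype.card I : ℝ) * η ^ 2 := by positivity
  split_ifs <;> nlinarith

/-! ### Exponential moments of a column's score -/

/-- The remainder does not involve the sign. So in `col_exp_le` the strategy enters only through the
correlation, and the second-order term is bounded by moments of the score alone. -/
theorem exp_neg_sgn_mul_le (b : ℤˣ) (y : ℝ) :
    Real.exp (-(sgn b * y)) ≤ 1 - sgn b * y + (Real.exp y + Real.exp (-y) - 2) := by
  rcases sgn_eq b with h | h <;> rw [h]
  · rw [one_mul]; linarith [Real.add_one_le_exp y]
  · rw [neg_one_mul, neg_neg]; linarith [Real.add_one_le_exp (-y)]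

theorem colLaw_mgf_le {η u s : ℝ} (hη : 0 < η) (h0 : η ≤ u) (h1 : u ≤ 1 - η)
    (hs : 2 * |s| ≤ η) (hs' : 12 * Fintype.card I * s ^ 2 ≤ 1) :
    ∑ x : I → ℤˣ, colLaw u x * Real.exp (s * colScore u x) ≤
      1 + 24 * Fintype.card I * s ^ 2 := by
  calc _ = ∑ x : I → ℤˣ, ∏ i, (bias u (x i) * Real.exp (s * biasScore u (x i))) := by
        refine sum_congr rfl fun x _ => ?_
        rw [prod_mul_distrib, ← Real.exp_sum, ← mul_sum]
        rfl
    _ = ∏ _i : I, ∑ b, bias u b * Real.exp (s * biasScore u b) :=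
        sum_pi_prod fun _ b => bias u b * Real.exp (s * biasScore u b)
    _ ≤ ∏ _i : I, Real.exp (12 * s ^ 2) := by
        refine prod_le_prod (fun i _ => sum_nonneg fun b _ =>
          mul_nonneg (bias_nonneg (by linarith) (by linarith) b) (Real.exp_pos _).le)
          fun i _ => bias_mgf_le hη h0 h1 hs
    _ = Real.exp (12 * Fintype.card I * s ^ 2) := by
        rw [prod_const, card_univ, ← Real.exp_nat_mul]
        congr 1; ring
    _ ≤ _ := by
        have hx0 : 0 ≤ 12 * Fintype.card I * s ^ 2 := by positivity
        have := (abs_le.1 (Real.abs_exp_sub_one_sub_id_le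
          (x := 12 * Fintype.card I * s ^ 2) (by rwa [abs_of_nonneg hx0]))).2
        nlinarith

theorem col_exp_le {η u t : ℝ} (hη : 0 < η) (h0 : η ≤ u) (h1 : u ≤ 1 - η) (ht0 : 0 ≤ t)
    (ht : 2 * t ≤ η) (ht' : 12 * Fintype.card I * t ^ 2 ≤ 1) (f : (I → ℤˣ) → ℤˣ) :
    ∑ x : I → ℤˣ, colLaw u x * Real.exp (-(t * (sgn (f x) * colScore u x))) ≤
      1 - t * colCorr f u + 48 * Fintype.card I * t ^ 2 := by
  have hp := colLaw_mgf_le (I := I) (s := t) hη h0 h1 (by rwa [abs_of_nonneg ht0]) ht'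
  have hm := colLaw_mgf_le (I := I) (s := -t) hη h0 h1 (by rwa [abs_neg, abs_of_nonneg ht0])
    (by rwa [neg_sq])
  calc _ ≤ ∑ x : I → ℤˣ, (colLaw u x - t * (colLaw u x * colScore u x * sgn (f x)) +
        (colLaw u x * Real.exp (t * colScore u x) + colLaw u x * Real.exp (-t * colScore u x)
          - 2 * colLaw u x)) := by
        refine sum_le_sum fun x _ => ?_
        have := mul_le_mul_of_nonneg_left (exp_neg_sgn_mul_le (f x) (t * colScore u x))
          (colLaw_nonneg (u := u) (by linarith) (by linarith) x)
        rw [show t * (sgn (f x) * colScore u x) = sgn (f x) * (t * colScore u x) by ring,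
          neg_mul]
        linarith
    _ ≤ _ := by
        rw [sum_add_distrib, sum_sub_distrib, sum_sub_distrib, sum_add_distrib, ← mul_sum,
          ← mul_sum, colLaw_sum]
        rw [neg_sq] at hm
        simp only [colCorr]
        linarith

end Column

/-! ### Reduction to columnwise strategies -/

/-- The adversary gains nothing from seeing all columns at once: a product of column functionals is
maximized by a strategy that acts on each column separately. -/
theorem sum_columns_le {Θ I J : Type} [Fintype Θ] [Fintype I] [DecidableEq I] [Fintype J]
    [DecidableEq J] (H : Θ → (I → ℤˣ) → ℤˣ → ℝ) (hH : ∀ θ y b, 0 ≤ H θ y b)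
    (p : (I → J → ℤˣ) → (J → ℤˣ) → ℝ) (hp0 : ∀ x a, 0 ≤ p x a) (hp1 : ∀ x, ∑ a, p x a = 1)
    (B : ℝ) (hB : ∀ f : (I → ℤˣ) → ℤˣ, ∑ y, ∑ θ, H θ y (f y) ≤ B) :
    ∑ θ : J → Θ, ∑ x : I → J → ℤˣ, ∑ a, p x a * ∏ j, H (θ j) (fun i => x i j) (a j) ≤
      B ^ Fintype.card J := by
  -- With the secrets summed out, the factor of a column depends only on what the coalition sees
  -- there and on the bit output; `f` is the best response.
  have hmax : ∀ y : I → ℤˣ, ∃ b, ∀ b', ∑ θ, H θ y b' ≤ ∑ θ, H θ y b := fun y => by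
    obtain ⟨b, -, hb⟩ := exists_max_image univ (fun b => ∑ θ, H θ y b) univ_nonempty
    exact ⟨b, fun b' => hb b' (mem_univ _)⟩
  choose f hf using hmax
  calc _ = ∑ x : I → J → ℤˣ, ∑ a, p x a * ∏ j, ∑ θ, H θ (fun i => x i j) (a j) := by
        rw [sum_comm]
        refine sum_congr rfl fun x _ => ?_
        rw [sum_comm]
        refine sum_congr rfl fun a _ => ?_
        rw [← mul_sum, sum_pi_prod fun j θ => H θ (fun i => x i j) (a j)]
    _ ≤ ∑ x : I → J → ℤˣ, ∑ a, p x a * ∏ j, ∑ θ, H θ (fun i => x i j) (f fun i => x i j) := by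
        refine sum_le_sum fun x _ => sum_le_sum fun a _ =>
          mul_le_mul_of_nonneg_left ?_ (hp0 x a)
        exact prod_le_prod (fun j _ => sum_nonneg fun θ _ => hH _ _ _) fun j _ => hf _ _
    _ = ∑ z : J → I → ℤˣ, ∏ j, ∑ θ, H θ (z j) (f (z j)) := by
        simp only [← sum_mul, hp1, one_mul]
        exact (Equiv.piComm fun (_ : I) (_ : J) => ℤˣ).sum_comp
          fun z : J → I → ℤˣ => ∏ j, ∑ θ, H θ (z j) (f (z j))
    _ = ∏ _j : J, ∑ y, ∑ θ, H θ y (f y) := sum_pi_prod fun _ y => ∑ θ, H θ y (f y)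
    _ ≤ ∏ _j : J, B := prod_le_prod
        (fun j _ => sum_nonneg fun y _ => sum_nonneg fun θ _ => hH _ _ _) fun j _ => hB f
    _ = _ := by rw [prod_const, card_univ]

/-! ### The tracing code -/

/-- The secret of a column: a node of the partition, or the value of a constant column. -/
abbrev Secret (M : ℕ) : Type := Fin M ⊕ ℤˣ

/-- The law of the secret of a column. -/
noncomputable def secretLaw (γ : ℝ) (M : ℕ) : Secret M → ℝ
  | .inl _ => γ / M
  | .inr _ => (1 - γ) / 2

/-- The law of a bit of a column with a given secret. -/
noncomputable def bitLaw (η : ℝ) (M : ℕ) : Secret M → ℤˣ → ℝ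
  | .inl k, b => bias (node η M k) b
  | .inr b', b => if b = b' then 1 else 0

/-- The score of a bit of a column with a given secret. -/
noncomputable def bitScore (η : ℝ) (M : ℕ) : Secret M → ℤˣ → ℝ
  | .inl k, b => biasScore (node η M k) b
  | .inr _, _ => 0

/-- The indicator of an error of the pirate word at a constant column. -/
noncomputable def penalty {M : ℕ} : Secret M → ℤˣ → ℝ
  | .inl _, _ => 0
  | .inr b, b' => wrong b b'

section

variable {γ η : ℝ} {M : ℕ}

theorem secretLaw_nonneg (h0 : 0 ≤ γ) (h1 : γ ≤ 1) (θ : Secret M) : 0 ≤ secretLaw γ M θ := by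
  rcases θ with k | b
  · exact div_nonneg h0 (Nat.cast_nonneg _)
  · simp only [secretLaw]; linarith

theorem secretLaw_sum (hM : 0 < M) : ∑ θ, secretLaw γ M θ = 1 := by
  have hM' : (M : ℝ) ≠ 0 := by exact_mod_cast hM.ne'
  rw [Fintype.sum_sum_type, sum_units]
  simp only [secretLaw, sum_const, card_univ, Fintype.card_fin, nsmul_eq_mul]
  field_simp
  ring

theorem bitLaw_nonneg (hη : 0 < η) (hη' : η ≤ 1 / 4) (θ : Secret M) (b : ℤˣ) :
    0 ≤ bitLaw η M θ b := by
  rcases θ with k | b'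
  · have := node_mem hη' k.2.le (Nat.zero_lt_of_lt k.2)
    exact bias_nonneg (by linarith [this.1]) (by linarith [this.2]) b
  · simp only [bitLaw]; split_ifs <;> norm_num

theorem bitLaw_sum (θ : Secret M) : ∑ b, bitLaw η M θ b = 1 := by
  rcases θ with k | b'
  · exact bias_sum _
  · simp only [bitLaw, sum_ite_eq', mem_univ, if_true]

theorem bitLaw_mgf_le (hη : 0 < η) (hη' : η ≤ 1 / 4) {s : ℝ} (hs : 2 * |s| ≤ η) (θ : Secret M) :
    ∑ b, bitLaw η M θ b * Real.exp (s * bitScore η M θ b) ≤ Real.exp (12 * s ^ 2) := by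
  rcases θ with k | b'
  · have := node_mem hη' k.2.le (Nat.zero_lt_of_lt k.2)
    exact bias_mgf_le hη this.1 this.2 hs
  · simp only [bitScore, mul_zero, Real.exp_zero, mul_one, bitLaw_sum]
    exact Real.one_le_exp (by positivity)

theorem sum_const_column {I : Type} [Fintype I] [DecidableEq I] (b : ℤˣ)
    (h : (I → ℤˣ) → ℝ) :
    ∑ x : I → ℤˣ, (∏ i, if x i = b then (1 : ℝ) else 0) * h x = h fun _ => b := by
  have : ∀ x : I → ℤˣ, (∏ i, if x i = b then (1 : ℝ) else 0) * h x =
      if x = fun _ => b then h x else 0 := by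
    intro x
    rw [prod_ite_zero]
    simp [funext_iff]
  simp [this]

/-- Elementary estimate behind `column_bound`; here `T` is `t / (1 - 2 * η)`. -/
theorem column_estimate {n t T κ v : ℝ} (hn : 1 ≤ n) (hγ : 0 < γ) (hγ' : γ ≤ 1 / 2) (ht : 0 < t)
    (htn : 352 * n * t = γ) (hT : t ≤ T) (hT' : T ≤ 2 * t) (hκ : κ * (1 - γ) = 4 * γ * T)
    (hv : v ≤ κ + 2 * κ ^ 2) :
    (1 / 2 - γ) * v + γ ^ 2 * t / 2 ≤ γ * T * (2 - γ) - 48 * γ * n * t ^ 2 := by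
  have hκ0 : 0 ≤ κ := by
    by_contra h
    push Not at h
    have : 0 ≤ 4 * γ * T := by
      have : 0 ≤ T := by linarith
      positivity
    nlinarith
  have hκ1 : κ ≤ 16 * γ * t := by
    have : 4 * γ * T ≤ 8 * γ * t := by nlinarith
    nlinarith
  have h1 : (1 / 2 - γ) * κ ≤ 2 * γ * T * (1 - γ) := by
    -- Uses 1/2 - γ ≤ (1 - γ)² / 2; the slack γ²/2 is what keeps the final gain positive.
    have : (1 / 2 - γ) * κ ≤ (1 - γ) / 2 * ((1 - γ) * κ) := by
      nlinarith [mul_nonneg hκ0 (sq_nonneg γ)]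
    nlinarith
  have h2 : κ ^ 2 ≤ 128 * γ * t ^ 2 := by
    have : κ ^ 2 ≤ (16 * γ * t) ^ 2 := pow_le_pow_left₀ hκ0 hκ1 2
    have h3 : γ * (γ * t ^ 2) ≤ 1 / 2 * (γ * t ^ 2) :=
      mul_le_mul_of_nonneg_right hγ' (by positivity)
    nlinarith
  have h3 : (1 / 2 - γ) * v ≤ (1 / 2 - γ) * κ + κ ^ 2 := by
    have : (1 / 2 - γ) * v ≤ (1 / 2 - γ) * (κ + 2 * κ ^ 2) :=
      mul_le_mul_of_nonneg_left hv (by linarith)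
    nlinarith [mul_nonneg hγ.le (sq_nonneg κ)]
  have h4 : γ ^ 2 * t = 352 * (γ * n * t ^ 2) := by
    -- The constant is 352 = 2(48 + 128): half of γ²t pays for the second-order term 48γnt² and for
    -- κ² ≤ 128γt².
    rw [sq, mul_assoc]; nth_rewrite 2 [← htn]; ring
  have h5 : γ * t ^ 2 ≤ γ * n * t ^ 2 := by
    have : 0 ≤ γ * t ^ 2 := by positivity
    nlinarith
  have h6 : γ ^ 2 * t ≤ γ ^ 2 * T := mul_le_mul_of_nonneg_left hT (by positivity)
  nlinarith

theorem sum_inl_le {I : Type} [Fintype I] [DecidableEq I] {t v : ℝ} (hγ : 0 < γ) (hη : 0 < η)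
    (hη' : η ≤ 1 / 4) (hM : 0 < M) (ht : 0 < t) (ht2 : 2 * t ≤ η)
    (ht' : 12 * Fintype.card I * t ^ 2 ≤ 1) (f : (I → ℤˣ) → ℤˣ) :
    ∑ k : Fin M, ∑ x : I → ℤˣ, secretLaw γ M (.inl k) * (∏ i, bitLaw η M (.inl k) (x i)) *
      Real.exp (-(t * (sgn (f x) * ∑ i, bitScore η M (.inl k) (x i)) +
        v * penalty (M := M) (.inl k) (f x))) ≤
      γ * (1 - t * ((1 / M : ℝ) * ∑ k : Fin M, colCorr f (node η M k)) +
        48 * Fintype.card I * t ^ 2) := by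
  have hM' : (0 : ℝ) < M := by exact_mod_cast hM
  calc _ ≤ ∑ k : Fin M, γ / M * (1 - t * colCorr f (node η M k) + 48 * Fintype.card I * t ^ 2) := by
        refine sum_le_sum fun k _ => ?_
        have hk := node_mem hη' k.2.le hM
        refine le_trans (le_of_eq ?_) (mul_le_mul_of_nonneg_left
          (col_exp_le hη hk.1 hk.2 ht.le ht2 ht' f) (by positivity))
        rw [mul_sum]
        refine sum_congr rfl fun x _ => ?_
        simp only [penalty, mul_zero, add_zero, secretLaw, mul_assoc]
        rfl
    _ = _ := by
        rw [← mul_sum, sum_add_distrib, sum_sub_distrib, ← mul_sum]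
        simp only [sum_const, card_univ, Fintype.card_fin, nsmul_eq_mul]
        field_simp

/-- Constant columns carry no score, so only the penalty acts; each of the two possible mistakes
multiplies its term by 1 - κ. -/
theorem sum_inr_eq {I : Type} [Fintype I] [DecidableEq I] {t κ v : ℝ}
    (hv : Real.exp (-v) = 1 - κ) (f : (I → ℤˣ) → ℤˣ) :
    ∑ b : ℤˣ, ∑ x : I → ℤˣ, secretLaw γ M (.inr b) * (∏ i, bitLaw η M (.inr b) (x i)) *
      Real.exp (-(t * (sgn (f x) * ∑ i, bitScore η M (.inr b) (x i)) +
        v * penalty (M := M) (.inr b) (f x))) =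
      (1 - γ) / 2 * (2 - κ * (wrong 1 (f fun _ => 1) + wrong (-1) (f fun _ => -1))) := by
  have hb : ∀ b : ℤˣ, ∑ x : I → ℤˣ, secretLaw γ M (.inr b) *
      (∏ i, bitLaw η M (.inr b) (x i)) *
      Real.exp (-(t * (sgn (f x) * ∑ i, bitScore η M (.inr b) (x i)) +
        v * penalty (M := M) (.inr b) (f x))) =
      (1 - γ) / 2 * (1 - κ * wrong b (f fun _ => b)) := by
    intro b
    simp only [bitScore, sum_const_zero, mul_zero, zero_add, penalty, secretLaw, bitLaw,
      mul_assoc]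
    rw [← mul_sum, sum_const_column b fun x => Real.exp (-(v * wrong b (f x)))]
    congr 1
    unfold wrong
    split_ifs
    · simp
    · simp [hv]
  simp only [hb, sum_units]
  ring

/-- One column contributes its share to the joint exponential moment of the scores of the coalition
and the penalties. -/
theorem column_bound {I : Type} [Fintype I] [DecidableEq I] {t κ v : ℝ}
    (hn : 1 ≤ Fintype.card I) (hγ : 0 < γ) (hγ' : γ ≤ 1 / 2) (hη : 0 < η) (hη' : η ≤ 1 / 4)
    (hηn : 24 * Fintype.card I * η ^ 2 = γ) (hM : 0 < M) (ht : 0 < t)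
    (htn : 352 * Fintype.card I * t = γ) (hκ : κ * ((1 - 2 * η) * (1 - γ)) = 4 * γ * t)
    (hv : Real.exp (-v) = 1 - κ) (hv' : v ≤ κ + 2 * κ ^ 2) (f : (I → ℤˣ) → ℤˣ)
    (hf : colMean f (1 - η) - colMean f η - γ / 2 ≤
      (1 - 2 * η) / M * ∑ k : Fin M, colCorr f (node η M k)) :
    ∑ x : I → ℤˣ, ∑ θ, secretLaw γ M θ * (∏ i, bitLaw η M θ (x i)) *
        Real.exp (-(t * (sgn (f x) * ∑ i, bitScore η M θ (x i)) + v * penalty θ (f x))) ≤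
      Real.exp (-((1 / 2 - γ) * v + γ ^ 2 * t / 2)) := by
  set n : ℝ := (Fintype.card I : ℝ) with hn_def
  have hn' : 1 ≤ n := by rw [hn_def]; exact_mod_cast hn
  have hM' : (0 : ℝ) < M := by exact_mod_cast hM
  have hL : 0 < 1 - 2 * η := by linarith
  have hηγ : γ / (24 * n) ≤ η := by
    have h1 : n * η ^ 2 ≤ n * η := mul_le_mul_of_nonneg_left (by nlinarith) (by linarith)
    rw [div_le_iff₀ (by positivity)]; linarith
  have hnt : t ≤ n * t := le_mul_of_one_le_left ht.le hn'
  have ht2 : 2 * t ≤ η := by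
    refine le_trans ?_ hηγ
    rw [le_div_iff₀ (by positivity)]; linarith
  have ht3 : n * t ≤ 1 / 352 := by linarith
  have ht' : 12 * n * t ^ 2 ≤ 1 := by
    have : n * t * t ≤ 1 / 352 * (1 / 352) :=
      mul_le_mul ht3 (by linarith) ht.le (by norm_num)
    linarith
  set W := wrong 1 (f fun _ => 1) + wrong (-1) (f fun _ => -1) with hW
  set A := (1 / M : ℝ) * ∑ k : Fin M, colCorr f (node η M k) with hA
  have hinl := sum_inl_le (v := v) hγ hη hη' hM ht ht2 ht' f
  have hinr := sum_inr_eq (γ := γ) (η := η) (M := M) (t := t) hv f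
  rw [← hn_def, ← hA] at hinl
  rw [← hW] at hinr
  have h3η : 3 * η ^ 2 ≤ 1 := by
    have : η ^ 2 ≤ (1 / 4) ^ 2 := pow_le_pow_left₀ hη.le hη' 2
    linarith
  have hη3 := pow_pos hη 3
  have hm1 := colMean_ge (u := 1 - η) (η := η) (by linarith) (by linarith) 1 h3η
    (by rw [bias_one]; linarith) f
  have hm2 := colMean_ge (u := η) (η := η) (by linarith) (by linarith) (-1) h3η
    (by rw [bias_neg_one]; linarith) f
  rw [sgn_one, one_mul] at hm1
  rw [sgn_neg_one, neg_one_mul] at hm2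
  rw [← hn_def] at hm1 hm2
  -- The loss γ is γ/2 from the Riemann sum and 6nη² = γ/4 from each end.
  have hA1 : 2 - γ - 2 * W ≤ (1 - 2 * η) * A := by
    have : (1 - 2 * η) * A = (1 - 2 * η) / M * ∑ k : Fin M, colCorr f (node η M k) := by
      rw [hA]; ring
    rw [this]
    linarith
  obtain ⟨T, hT⟩ : ∃ T, T = t / (1 - 2 * η) := ⟨_, rfl⟩
  have hT0 : T * (1 - 2 * η) = t := by rw [hT]; field_simp
  have hTpos : 0 < T := by rw [hT]; positivity
  have hA2 : T * (2 - γ - 2 * W) ≤ t * A := by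
    calc _ ≤ T * ((1 - 2 * η) * A) := mul_le_mul_of_nonneg_left hA1 hTpos.le
      _ = t * A := by rw [← hT0]; ring
  have hκ' : κ * (1 - γ) = 4 * γ * T := by
    have : κ * (1 - γ) * (1 - 2 * η) = 4 * γ * T * (1 - 2 * η) := by
      rw [mul_assoc (4 * γ), hT0, ← hκ]; ring
    exact mul_right_cancel₀ hL.ne' this
  have hηT : 0 < η * T := mul_pos hη hTpos
  have hηT' : η * T ≤ 1 / 4 * T := mul_le_mul_of_nonneg_right hη' hTpos.le
  have hest := column_estimate hn' hγ hγ' ht htn (by linarith) (by linarith) hκ' hv'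
  rw [sum_comm, Fintype.sum_sum_type, hinr]
  refine le_trans (add_le_add_left hinl _) ?_
  refine le_trans ?_ (Real.add_one_le_exp _)
  -- The choice of κ makes the penalty for mistakes equal the score they save, so `W` drops out.
  have hκW : (1 - γ) / 2 * (κ * W) = 2 * γ * T * W := by
    rw [show (1 - γ) / 2 * (κ * W) = κ * (1 - γ) * W / 2 by ring, hκ']; ring
  have hA3 := mul_le_mul_of_nonneg_left hA2 hγ.le
  linarith

end

/-! ### The random code and the scores of innocents and colluders -/

/-- The code: the columns are independent, each with its own secret, and given the secrets all bits
are independent. -/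
noncomputable def codeModel {γ η : ℝ} {M : ℕ} (hγ : 0 ≤ γ) (hγ' : γ ≤ 1) (hη : 0 < η)
    (hη' : η ≤ 1 / 4) (hM : 0 < M) (ℓ : ℕ) : RowModel (Fin ℓ → Secret M) (Fin ℓ → ℤˣ) where
  μ θ := ∏ j, secretLaw γ M (θ j)
  ρ θ r := ∏ j, bitLaw η M (θ j) (r j)
  μ_nonneg θ := prod_nonneg fun _ _ => secretLaw_nonneg hγ hγ' _
  ρ_nonneg θ r := prod_nonneg fun _ _ => bitLaw_nonneg hη hη' _ _
  μ_sum := by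
    rw [sum_pi_prod fun _ => secretLaw γ M]
    simp only [secretLaw_sum hM, prod_const_one]
  ρ_sum θ := by
    rw [sum_pi_prod fun j => bitLaw η M (θ j)]
    simp only [bitLaw_sum, prod_const_one]

/-- The score of the codeword `r` against the pirate word `a`. -/
noncomputable def score (η : ℝ) {M ℓ : ℕ} (θ : Fin ℓ → Secret M) (r a : Fin ℓ → ℤˣ) : ℝ :=
  ∑ j, sgn (a j) * bitScore η M (θ j) (r j)

section

variable {γ η : ℝ} {M ℓ : ℕ}

/-- The score of an innocent user is rarely large. -/
theorem innocent_bound (hη : 0 < η) (hη' : η ≤ 1 / 4) {s : ℝ} (hs0 : 0 ≤ s) (hs : 2 * s ≤ η)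
    (σ : ℝ) (θ : Fin ℓ → Secret M) (a : Fin ℓ → ℤˣ) :
    ∑ r : Fin ℓ → ℤˣ, (∏ j, bitLaw η M (θ j) (r j)) * (if σ < score η θ r a then 1 else 0) ≤
      Real.exp (-(s * σ) + 12 * s ^ 2 * ℓ) := by
  calc _ ≤ ∑ r : Fin ℓ → ℤˣ, Real.exp (-(s * σ)) * ∏ j, (bitLaw η M (θ j) (r j) *
          Real.exp (s * sgn (a j) * bitScore η M (θ j) (r j))) := by
        refine sum_le_sum fun r _ => ?_
        rw [prod_mul_distrib, mul_left_comm]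
        refine mul_le_mul_of_nonneg_left ?_ (prod_nonneg fun _ _ => bitLaw_nonneg hη hη' _ _)
        rw [← Real.exp_sum, ← Real.exp_add]
        have : ∑ j, s * sgn (a j) * bitScore η M (θ j) (r j) = s * score η θ r a := by
          simp only [score, mul_sum, mul_assoc]
        rw [this]
        split_ifs with h
        · exact Real.one_le_exp (by nlinarith)
        · positivity
    _ = Real.exp (-(s * σ)) * ∏ j, ∑ b, bitLaw η M (θ j) b *
          Real.exp (s * sgn (a j) * bitScore η M (θ j) b) := by
        rw [← mul_sum, sum_pi_prod fun j b => bitLaw η M (θ j) b *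
          Real.exp (s * sgn (a j) * bitScore η M (θ j) b)]
    _ ≤ Real.exp (-(s * σ)) * ∏ _j : Fin ℓ, Real.exp (12 * s ^ 2) := by
        refine mul_le_mul_of_nonneg_left (prod_le_prod (fun j _ => sum_nonneg fun b _ =>
          mul_nonneg (bitLaw_nonneg hη hη' _ _) (Real.exp_pos _).le) fun j _ => ?_)
          (Real.exp_pos _).le
        -- The moment bound is even in the tilt, so the pirate's sign is irrelevant.
        have h1 : |s * sgn (a j)| = s := by rw [abs_mul, abs_sgn, mul_one, abs_of_nonneg hs0]
        have h2 : (s * sgn (a j)) ^ 2 = s ^ 2 := by rw [← sq_abs, h1]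
        rw [← h2]
        exact bitLaw_mgf_le hη hη' (by rwa [h1]) (θ j)
    _ = _ := by
        rw [prod_const, card_univ, Fintype.card_fin, ← Real.exp_nat_mul, ← Real.exp_add]
        congr 1; ring

/-- If the pirate word makes few errors at the constant columns, then the score of some colluder is
large, up to a small probability. -/
theorem colluder_bound {I : Type} [Fintype I] [DecidableEq I] (hγ : 0 ≤ γ) (hγ' : γ ≤ 1)
    (hη : 0 < η) (hη' : η ≤ 1 / 4) {t v β σ Z : ℝ} (ht : 0 ≤ t) (hv : 0 ≤ v)
    (P : (I → Fin ℓ → ℤˣ) → PMF (Fin ℓ → ℤˣ))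
    (hZ : ∀ f : (I → ℤˣ) → ℤˣ,
      ∑ x : I → ℤˣ, ∑ θ, secretLaw γ M θ * (∏ i, bitLaw η M θ (x i)) *
        Real.exp (-(t * (sgn (f x) * ∑ i, bitScore η M θ (x i)) + v * penalty θ (f x))) ≤
      Real.exp Z) :
    ∑ θ : Fin ℓ → Secret M, (∏ j, secretLaw γ M (θ j)) *
        ∑ x : I → Fin ℓ → ℤˣ, (∏ i, ∏ j, bitLaw η M (θ j) (x i j)) *
          ∑ a, (P x a).toReal *
            (if ∑ j, penalty (θ j) (a j) ≤ β * ℓ ∧ ∀ i, score η θ (x i) a ≤ σ then 1 else 0) ≤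
      Real.exp (t * (Fintype.card I * σ) + v * (β * ℓ) + ℓ * Z) := by
  set H : Secret M → (I → ℤˣ) → ℤˣ → ℝ := fun θ y b =>
    secretLaw γ M θ * (∏ i, bitLaw η M θ (y i)) *
      Real.exp (-(t * (sgn b * ∑ i, bitScore η M θ (y i)) + v * penalty θ b)) with hH
  have hw : ∀ (θ : Secret M) (y : I → ℤˣ), 0 ≤ secretLaw γ M θ * (∏ i, bitLaw η M θ (y i)) :=
    fun θ y => mul_nonneg (secretLaw_nonneg hγ hγ' _)
      (prod_nonneg fun _ _ => bitLaw_nonneg hη hη' _ _)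
  have hmain := sum_columns_le (J := Fin ℓ) H
    (fun θ y b => mul_nonneg (hw θ y) (Real.exp_pos _).le)
    (fun x a => (P x a).toReal) (fun x a => ENNReal.toReal_nonneg) (fun x => sum_toReal _)
    (Real.exp Z) hZ
  set c := t * (Fintype.card I * σ) + v * (β * ℓ) with hc
  calc _ ≤ ∑ θ : Fin ℓ → Secret M, ∑ x : I → Fin ℓ → ℤˣ, ∑ a, Real.exp c *
          ((P x a).toReal * ∏ j, H (θ j) (fun i => x i j) (a j)) := by
        refine sum_le_sum fun θ _ => ?_
        rw [mul_sum]
        refine sum_le_sum fun x _ => ?_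
        rw [← mul_assoc, mul_sum]
        refine sum_le_sum fun a _ => ?_
        have h1 : (∏ j, secretLaw γ M (θ j)) * ∏ i, ∏ j, bitLaw η M (θ j) (x i j) =
            ∏ j, (secretLaw γ M (θ j) * ∏ i, bitLaw η M (θ j) (x i j)) := by
          rw [prod_mul_distrib, prod_comm]
        have h2 : ∏ j, H (θ j) (fun i => x i j) (a j) =
            (∏ j, (secretLaw γ M (θ j) * ∏ i, bitLaw η M (θ j) (x i j))) *
              Real.exp (-(t * ∑ i, score η θ (x i) a + v * ∑ j, penalty (θ j) (a j))) := by
          simp only [hH]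
          rw [prod_mul_distrib, ← Real.exp_sum]
          congr 2
          rw [sum_neg_distrib, sum_add_distrib, ← mul_sum, ← mul_sum]
          simp only [score, mul_sum]
          rw [sum_comm]
        rw [h1, h2]
        calc _ = ((P x a).toReal * ∏ j, (secretLaw γ M (θ j) *
              ∏ i, bitLaw η M (θ j) (x i j))) *
              (if ∑ j, penalty (θ j) (a j) ≤ β * ℓ ∧ ∀ i, score η θ (x i) a ≤ σ then 1 else 0) := by
              ring
          _ ≤ ((P x a).toReal * ∏ j, (secretLaw γ M (θ j) *
              ∏ i, bitLaw η M (θ j) (x i j))) * (Real.exp c *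
              Real.exp (-(t * ∑ i, score η θ (x i) a + v * ∑ j, penalty (θ j) (a j)))) := by
              refine mul_le_mul_of_nonneg_left ?_ (mul_nonneg ENNReal.toReal_nonneg
                (prod_nonneg fun j _ => hw (θ j) fun i => x i j))
              rw [← Real.exp_add]
              split_ifs with h
              · refine Real.one_le_exp ?_
                -- Only the total score of the coalition is controlled; a total above nσ forces some
                -- individual score above σ.
                have h3 : ∑ i, score η θ (x i) a ≤ Fintype.card I * σ := by
                  have := sum_le_sum fun i (_ : i ∈ univ) => h.2 i
                  simpa using this
                have h4 := mul_le_mul_of_nonneg_left h3 ht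
                have h5 := mul_le_mul_of_nonneg_left h.1 hv
                linarith
              · positivity
          _ = _ := by ring
    _ = Real.exp c * ∑ θ : Fin ℓ → Secret M, ∑ x : I → Fin ℓ → ℤˣ, ∑ a,
          ((P x a).toReal * ∏ j, H (θ j) (fun i => x i j) (a j)) := by
        simp only [mul_sum]
    _ ≤ Real.exp c * Real.exp Z ^ Fintype.card (Fin ℓ) :=
        mul_le_mul_of_nonneg_left hmain (Real.exp_pos _).le
    _ = _ := by rw [Fintype.card_fin, ← Real.exp_nat_mul, ← Real.exp_add]

/-- The penalties count errors of the pirate word. -/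
theorem sum_penalty_le_errors {N : ℕ} (θ : Fin ℓ → Secret M) (C : Codebook N ℓ)
    (hC : ∀ i j, bitLaw η M (θ j) (C i j) ≠ 0) (a : Fin ℓ → ℤˣ) :
    ∑ j, penalty (θ j) (a j) ≤ errors C a := by
  have h1 : (errors C a : ℝ) = ∑ j, if ¬ ∃ i : Fin N, a j = C i j then (1 : ℝ) else 0 := by
    rw [errors, Set.ncard_eq_toFinset_card', Set.toFinset_ofPred, card_filter]
    push_cast
    rfl
  rw [h1]
  refine sum_le_sum fun j _ => ?_
  have hj := fun i => hC i j
  rcases hθ : θ j with k | b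
  · simp only [penalty]; split_ifs <;> norm_num
  · simp only [penalty, wrong]
    by_cases hb : a j = b
    · rw [if_pos hb]; split_ifs <;> norm_num
    · rw [if_neg hb, if_pos]
      -- In a constant column every row of positive probability carries the bit `b`, so a deviation
      -- from `b` matches no user.
      rintro ⟨i, hi⟩
      have := hj i
      rw [hθ] at this
      simp only [bitLaw, ne_eq, ite_eq_right_iff, one_ne_zero, imp_false, not_not] at this
      exact hb (hi.trans this)

/-- Consistency bounds the penalties by βℓ, and an unaccused coalition has all scores at most σ. The
resulting event no longer involves the other users. -/
theorem prob_untraced_le {N : ℕ} {β : ℝ} (hγ : 0 ≤ γ) (hγ' : γ ≤ 1) (hη : 0 < η)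
    (hη' : η ≤ 1 / 4) (hM : 0 < M) (σ : ℝ) (S : Finset (Fin N)) (P : Adversary ℓ S) :
    prob (game ((codeModel hγ hγ' hη hη' hM ℓ).scheme id (fun θ r a => σ < score η θ r a) N) S P)
        {ω | Consistent β ω.1 ω.2.2 ∧ ω.2.1 ω.2.2 ∩ S = ∅} ≤
      ∑ θ : Fin ℓ → Secret M, (∏ j, secretLaw γ M (θ j)) *
        ∑ x : S → Fin ℓ → ℤˣ, (∏ i, ∏ j, bitLaw η M (θ j) (x i j)) *
          ∑ a, (P x a).toReal *
            (if ∑ j, penalty (θ j) (a j) ≤ β * ℓ ∧ ∀ i, score η θ (x i) a ≤ σ then 1 else 0) := by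
  refine (codeModel hγ hγ' hη hη' hM ℓ).prob_game_le_coalition id
    (fun θ r a => σ < score η θ r a) S P _ (fun θ x a =>
      ∑ j, penalty (θ j) (a j) ≤ β * ℓ ∧ ∀ i, score η θ (x i) a ≤ σ) ?_
  rintro θ r a hr ⟨hcons, hS0⟩
  refine ⟨(sum_penalty_le_errors (η := η) θ (fun i => r i) (fun i j => ?_) a).trans hcons,
    fun i => ?_⟩
  · exact prod_ne_zero_iff.1 (show ∏ j, bitLaw η M (θ j) (r i j) ≠ 0 from hr i) j (mem_univ j)
  · by_contra hi
    have : (i : Fin N) ∈ (univ.filter fun i => σ < score η θ (r i) a) ∩ S := by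
      simp only [mem_inter, mem_filter, mem_univ, true_and]
      exact ⟨not_le.1 hi, i.2⟩
    simp only at hS0
    rw [hS0] at this
    simp at this

/-- Parameters of the exponential moment for which the column bound holds. -/
theorem exists_tilt {n : ℝ} (hn : 1 ≤ n) (hγ : 0 < γ) (hγ' : γ ≤ 1 / 2) (hη' : η ≤ 1 / 4) :
    ∃ t κ v : ℝ, 0 < t ∧ 352 * n * t = γ ∧ κ * ((1 - 2 * η) * (1 - γ)) = 4 * γ * t ∧ 0 ≤ v ∧
      Real.exp (-v) = 1 - κ ∧ v ≤ κ + 2 * κ ^ 2 := by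
  obtain ⟨t, ht⟩ : ∃ t, t = γ / (352 * n) := ⟨_, rfl⟩
  have hn0 : 0 < n := by linarith
  have ht0 : 0 < t := by rw [ht]; positivity
  have htn : 352 * n * t = γ := by rw [ht]; field_simp
  have hL : 0 < (1 - 2 * η) * (1 - γ) := mul_pos (by linarith) (by linarith)
  obtain ⟨κ, hκ⟩ : ∃ κ, κ = 4 * γ * t / ((1 - 2 * η) * (1 - γ)) := ⟨_, rfl⟩
  have hκ0 : 0 ≤ κ := by rw [hκ]; positivity
  have hκ1 : κ ≤ 1 / 2 := by
    have h1 : 1 / 4 ≤ (1 - 2 * η) * (1 - γ) := by nlinarith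
    have h2 : t ≤ 1 / 352 := by
      have : t ≤ n * t := le_mul_of_one_le_left ht0.le hn
      linarith
    have h3 : γ * t ≤ 1 / 2 * (1 / 352) := mul_le_mul hγ' h2 ht0.le (by norm_num)
    rw [hκ, div_le_iff₀ hL]
    linarith
  obtain ⟨v, hv⟩ : ∃ v, v = -Real.log (1 - κ) := ⟨_, rfl⟩
  have hv0 : 0 ≤ v := by
    have := Real.log_nonpos (x := 1 - κ) (by linarith) (by linarith)
    linarith
  have hve : Real.exp (-v) = 1 - κ := by rw [hv, neg_neg, Real.exp_log (by linarith)]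
  have hv1 : v ≤ κ + 2 * κ ^ 2 := by
    have h1 := Real.one_sub_inv_le_log_of_pos (x := 1 - κ) (by linarith)
    have h2 : (1 - κ)⁻¹ ≤ 1 + κ + 2 * κ ^ 2 := by
      rw [inv_le_iff_one_le_mul₀ (by linarith)]
      nlinarith [mul_nonneg (sq_nonneg κ) (sub_nonneg.2 hκ1)]
    linarith
  exact ⟨t, κ, v, ht0, htn, by rw [hκ, div_mul_cancel₀ _ hL.ne'], hv0, hve, hv1⟩
end

/-! ### Choice of parameters and conclusion -/

/-- The two defining bounds from a bound on the failure to accuse a colluder. -/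
theorem isFingerprintingCode_and_tracesColluder {n N ℓ : ℕ} {β δ b d : ℝ} (F : Scheme N ℓ)
    (hb : 0 ≤ b) (hd : 0 ≤ d)
    (h1 : ∀ S : Finset (Fin N), S.card = n → ∀ P : Adversary ℓ S,
      prob (game F S P) {ω | δ * ((N : ℝ) - n) < ((ω.2.1 ω.2.2 \ S).card : ℝ)} ≤ b)
    (h2 : TracesColluder n β d F) :
    IsFingerprintingCode n β (b + d) δ F ∧ TracesColluder n β (b + d) F := by
  refine ⟨fun S hS P => ⟨?_, (h1 S hS P).trans (by linarith)⟩,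
    fun S hS P => (h2 S hS P).trans (by linarith)⟩
  refine le_trans ?_ ((h2 S hS P).trans (by linarith))
  refine ENNReal.toReal_mono ?_ (PMF.toOuterMeasure_mono _ ?_)
  · refine ne_top_of_le_ne_top ENNReal.one_ne_top ?_
    exact (PMF.toOuterMeasure_mono _ (Set.subset_univ _)).trans
      ((PMF.toOuterMeasure_apply_eq_one_iff _ Set.univ).2 (Set.subset_univ _)).le
  · intro ω hω
    have h := hω.1
    exact ⟨h.1, by rw [h.2]; simp⟩

/-- For `δ > 1 / 2` it suffices to accuse users at random. -/
theorem exists_scheme_of_half_lt {n N : ℕ} {β δ : ℝ} (hβ : 0 ≤ β) (hβ' : β < 1 / 2)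
    (hδ : 1 / 2 < δ) (hδ' : δ ≤ 1) :
    ∃ F : Scheme N 0,
      (∀ S : Finset (Fin N), S.card = n → ∀ P : Adversary 0 S,
        prob (game F S P) {ω | δ * ((N : ℝ) - n) < ((ω.2.1 ω.2.2 \ S).card : ℝ)} ≤
          min (δ * ((N : ℝ) - n)) ((2 : ℝ) ^ (-(1 / 2 * (δ * ((N : ℝ) - n)))))) ∧
      TracesColluder n β (δ ^ (1 / 8 * ((1 / 2 - β) * n))) F := by
  -- The allowed length tends to 0 as δ tends to 1, so the code is empty and each user is accused
  -- independently with probability δ/8.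
  let D : RowModel Unit Bool :=
    { μ := fun _ => 1
      ρ := fun _ r => if r then δ / 8 else 1 - δ / 8
      μ_nonneg := fun _ => zero_le_one
      ρ_nonneg := fun _ r => by cases r <;> simp <;> linarith
      μ_sum := by simp
      ρ_sum := fun _ => by simp }
  let row : Bool → Fin 0 → ℤˣ := fun _ _ => 1
  let A : Unit → Bool → (Fin 0 → ℤˣ) → Prop := fun _ r _ => r = true
  refine ⟨D.scheme row A N, fun S hS P => ?_, fun S hS P => ?_⟩
  · subst hS
    exact D.prob_false_accusation_le row A S P δ (by linarith) fun θ a => by simp [D, A]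
  · refine (D.prob_game_le_coalition row A S P _ (fun _ x _ => ∀ i, x i = false) ?_).trans ?_
    · rintro θ r a - ⟨-, h⟩ i
      by_contra hi
      have : (i : Fin N) ∈ (univ.filter fun i => A θ (r i) a) ∩ S := by
        simp [A, i.2, Bool.eq_true_of_not_eq_false hi]
      simp only at h
      rw [h] at this
      simp at this
    · have h1 : ∀ x : S → Bool, (∏ i, D.ρ () (x i)) *
          ∑ a, (P (fun i => row (x i)) a).toReal * (if ∀ i, x i = false then 1 else 0) =
          ∏ i, (D.ρ () (x i) * if x i = false then 1 else 0) := by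
        intro x
        rw [← sum_mul, sum_toReal, one_mul, prod_mul_distrib, prod_ite_zero]
        simp
      have h2 : ∑ x : S → Bool, ∏ i, (D.ρ () (x i) * if x i = false then (1 : ℝ) else 0) =
          (1 - δ / 8) ^ n := by
        rw [sum_pi_prod fun (_ : S) r => D.ρ () r * if r = false then (1 : ℝ) else 0, prod_const,
          card_univ, Fintype.card_coe, hS]
        simp [D]
      rw [Fintype.sum_unique, show D.μ default = 1 from rfl, one_mul]
      refine le_trans (le_of_eq ((sum_congr rfl fun x _ => h1 x).trans h2)) ?_
      rw [Real.rpow_def_of_pos (by linarith)]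
      calc (1 - δ / 8) ^ n ≤ Real.exp (-(δ / 8)) ^ n :=
            pow_le_pow_left₀ (by linarith) (by linarith [Real.add_one_le_exp (-(δ / 8))]) n
        _ = Real.exp (n * -(δ / 8)) := by rw [← Real.exp_nat_mul]
        _ ≤ _ := by
            refine Real.exp_le_exp.2 ?_
            have hlog : -1 ≤ Real.log δ := by
              have := Real.one_sub_inv_le_log_of_pos (x := δ) (by linarith)
              have h3 : δ⁻¹ ≤ 2 := by
                rw [inv_le_comm₀ (by linarith) two_pos]; linarith
              linarith
            -- The right side is at least -1/16, since log δ ≥ -1 and 1/2 - β ≤ 1/2; and δ > 1/2.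
            have h4 : -(δ / 8) ≤ Real.log δ * (1 / 8 * (1 / 2 - β)) := by nlinarith
            calc (n : ℝ) * -(δ / 8) ≤ n * (Real.log δ * (1 / 8 * (1 / 2 - β))) :=
                  mul_le_mul_of_nonneg_left h4 (Nat.cast_nonneg n)
              _ = _ := by ring

/-- For `δ ≤ 1 / 2` the tracing code of sufficient length works. -/
theorem exists_scheme_of_le_half {n N ℓ : ℕ} {β δ : ℝ} (hn : 1 ≤ n) (hβ : 0 ≤ β)
    (hβ' : β < 1 / 2) (hδ0 : 0 < δ) (hδ : δ ≤ 1 / 2)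
    (hℓ : 3072 * ((n : ℝ) ^ 2 * Real.log (1 / δ) / (1 / 2 - β) ^ 4) ≤ ℓ) :
    ∃ F : Scheme N ℓ,
      (∀ S : Finset (Fin N), S.card = n → ∀ P : Adversary ℓ S,
        prob (game F S P) {ω | δ * ((N : ℝ) - n) < ((ω.2.1 ω.2.2 \ S).card : ℝ)} ≤
          min (δ * ((N : ℝ) - n)) ((2 : ℝ) ^ (-(1 / 2 * (δ * ((N : ℝ) - n)))))) ∧
      TracesColluder n β (δ ^ (1 / 8 * ((1 / 2 - β) * n))) F := by
  obtain ⟨γ, hγdef⟩ : ∃ γ, γ = 1 / 2 - β := ⟨_, rfl⟩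
  have hβγ : β = 1 / 2 - γ := by linarith
  rw [← hγdef] at hℓ ⊢
  have hγ : 0 < γ := by linarith
  have hγ' : γ ≤ 1 / 2 := by linarith
  have hn' : (1 : ℝ) ≤ n := by exact_mod_cast hn
  have hn0 : (0 : ℝ) < n := by linarith
  set Λ := Real.log (1 / δ) with hΛ
  have hlog : Real.log δ = -Λ := by rw [hΛ, one_div, Real.log_inv, neg_neg]
  have hΛ0 : 0 ≤ Λ := Real.log_nonneg (by rw [le_div_iff₀ hδ0]; linarith)
  have hℓ' : 3072 * (n : ℝ) ^ 2 * Λ ≤ ℓ * γ ^ 4 := by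
    rw [mul_div_assoc', div_le_iff₀ (by positivity)] at hℓ
    linarith
  set η := Real.sqrt (γ / (24 * n)) with hηdef
  have hη2 : η ^ 2 = γ / (24 * n) := Real.sq_sqrt (by positivity)
  have hη : 0 < η := Real.sqrt_pos.2 (by positivity)
  have hηn : 24 * n * η ^ 2 = γ := by rw [hη2]; field_simp
  have hη' : η ≤ 1 / 4 := by
    have : η ^ 2 ≤ (1 / 4) ^ 2 := by
      have : η ^ 2 ≤ n * η ^ 2 := le_mul_of_one_le_left (sq_nonneg _) hn'
      linarith
    exact le_of_sq_le_sq this (by norm_num)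
  have hηγ : γ ≤ 24 * n * η := by
    have h1 : n * η ^ 2 ≤ n * η := mul_le_mul_of_nonneg_left (by nlinarith) hn0.le
    linarith
  -- One grid serves all coalitions and column strategies, as there are finitely many.
  obtain ⟨M, hM, hMf⟩ : ∃ M : ℕ, 0 < M ∧ ∀ (S : Finset (Fin N)) (f : (S → ℤˣ) → ℤˣ),
      colMean f (1 - η) - colMean f η - γ / 2 ≤
        (1 - 2 * η) / M * ∑ k : Fin M, colCorr f (node η M k) := by
    have h := Filter.eventually_all.2 fun S : Finset (Fin N) => Filter.eventually_all.2
      fun f : (S → ℤˣ) → ℤˣ => eventually_riemann_sum_ge hη hη'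
        (fun u hu => hasDerivAt_colMean (by linarith [hu.1]) (by linarith [hu.2]) f)
        (continuousOn_colCorr hη f) (half_pos hγ)
    obtain ⟨M, h1, h2⟩ := ((Filter.eventually_gt_atTop 0).and h).exists
    exact ⟨M, h1, h2⟩
  -- Then t·nσ is half of the coalition's guaranteed exponent ℓγ²t/2.
  set σ : ℝ := ℓ * γ ^ 2 / (4 * n) with hσ
  have hγ1 : γ ≤ 1 := by linarith
  let D := codeModel hγ.le hγ1 hη hη' hM ℓ
  let A : (Fin ℓ → Secret M) → (Fin ℓ → ℤˣ) → (Fin ℓ → ℤˣ) → Prop :=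
    fun θ r a => σ < score η θ r a
  refine ⟨D.scheme id A N, fun S hS P => ?_, fun S hS P => ?_⟩
  · have hacc : ∀ θ a, ∑ r, D.ρ θ r * (if A θ r a then 1 else 0) ≤ δ / 8 := by
      intro θ a
      -- The tilt s = σ/(24ℓ) minimizes -sσ + 12s²ℓ, giving -ℓγ⁴/(768n²); the length constant 3072 =
      -- 4·768 turns this into δ⁴ ≤ δ/8.
      refine (innocent_bound hη hη' (s := γ ^ 2 / (96 * n)) (by positivity) ?_ σ θ a).trans ?_
      · rw [mul_div_assoc', div_le_iff₀ (by positivity)]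
        nlinarith
      · calc _ ≤ Real.exp (4 * Real.log δ) := by
              refine Real.exp_le_exp.2 ?_
              have : -(γ ^ 2 / (96 * n) * σ) + 12 * (γ ^ 2 / (96 * n)) ^ 2 * ℓ =
                  -(ℓ * γ ^ 4 / (768 * n ^ 2)) := by
                rw [hσ]; field_simp; ring
              rw [this, hlog]
              have : 4 * Λ ≤ ℓ * γ ^ 4 / (768 * n ^ 2) := by
                rw [le_div_iff₀ (by positivity)]; linarith
              linarith
          _ = δ ^ 4 := by
              rw [show (4 : ℝ) * Real.log δ = ((4 : ℕ) : ℝ) * Real.log δ by norm_num,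
                Real.exp_nat_mul, Real.exp_log hδ0]
          _ ≤ δ / 8 := by
              have : δ ^ 3 ≤ (1 / 2) ^ 3 := pow_le_pow_left₀ hδ0.le hδ 3
              nlinarith
    subst hS
    exact D.prob_false_accusation_le id A S P δ hδ0 hacc
  · have hcard : Fintype.card S = n := by rw [Fintype.card_coe, hS]
    refine (prob_untraced_le hγ.le hγ1 hη hη' hM σ S P).trans ?_
    obtain ⟨t, κ, v, ht0, htn, hκ, hv0, hve, hv1⟩ := exists_tilt hn' hγ hγ' hη'
    refine (colluder_bound (I := S) (β := β) (σ := σ) (Z := -((1 / 2 - γ) * v + γ ^ 2 * t / 2))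
      hγ.le (by linarith) hη hη' ht0.le hv0 P fun f => ?_).trans ?_
    · refine column_bound (by rw [hcard]; exact hn) hγ hγ' hη hη' (by rw [hcard]; exact hηn) hM
        ht0 (by rw [hcard]; exact htn) hκ hve hv1 f (hMf S f)
    · rw [hcard, Real.rpow_def_of_pos hδ0, hlog, hβγ]
      refine Real.exp_le_exp.2 ?_
      -- Since β = 1/2 - γ, the terms in `v` cancel.
      have h1 : t * (n * σ) + v * ((1 / 2 - γ) * ℓ) +
          ℓ * -((1 / 2 - γ) * v + γ ^ 2 * t / 2) = -(ℓ * γ ^ 3 / (1408 * n)) := by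
        have ht : t = γ / (352 * n) := by rw [← htn]; field_simp
        rw [hσ, ht]; field_simp; ring
      rw [h1]
      have h2 : Λ * (1 / 8 * (γ * n)) ≤ ℓ * γ ^ 3 / (1408 * n) := by
        rw [le_div_iff₀ (by positivity)]
        have h3 : γ * (Λ * (1 / 8 * (γ * n)) * (1408 * n)) ≤ γ * (ℓ * γ ^ 3) := by
          have h4 : γ ^ 2 ≤ 1 := by nlinarith
          have h5 : γ ^ 2 * ((n : ℝ) ^ 2 * Λ) ≤ 1 * ((n : ℝ) ^ 2 * Λ) :=
            mul_le_mul_of_nonneg_right h4 (by positivity)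
          have h6 : 0 ≤ (n : ℝ) ^ 2 * Λ := by positivity
          linarith
        exact le_of_mul_le_mul_left h3 hγ
      linarith

end Fingerprinting

theorem mainTheorem6 :
    ∃ K c₁ c₂ : ℝ, 0 < K ∧ 0 < c₁ ∧ 0 < c₂ ∧
      ∀ (n N : ℕ) (β δ : ℝ), 1 ≤ n → n ≤ N → 0 ≤ β → β < 1 / 2 → 0 < δ → δ ≤ 1 →
        ∃ (ℓ : ℕ) (ε : ℝ) (F : Fingerprinting.Scheme N ℓ),
          (ℓ : ℝ) ≤ K * ((n : ℝ) ^ 2 * Real.log (1 / δ) / (1 / 2 - β) ^ 4) ∧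
          ε ≤ min (δ * ((N : ℝ) - n)) ((2 : ℝ) ^ (-(c₁ * (δ * ((N : ℝ) - n)))))
              + δ ^ (c₂ * ((1 / 2 - β) * n)) ∧
          Fingerprinting.IsFingerprintingCode n β ε δ F ∧
          Fingerprinting.TracesColluder n β ε F := by
  refine ⟨6144, 1 / 2, 1 / 8, by norm_num, by norm_num, by norm_num, ?_⟩
  intro n N β δ hn hnN hβ hβ' hδ hδ'
  have hnN' : (n : ℝ) ≤ N := by exact_mod_cast hnN
  have hb : 0 ≤ min (δ * ((N : ℝ) - n)) ((2 : ℝ) ^ (-(1 / 2 * (δ * ((N : ℝ) - n))))) :=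
    le_min (mul_nonneg hδ.le (by linarith)) (by positivity)
  have hd : 0 ≤ δ ^ (1 / 8 * ((1 / 2 - β) * n)) := by positivity
  have hγ : 0 < 1 / 2 - β := by linarith
  rcases lt_or_ge (1 / 2) δ with h | h
  · obtain ⟨F, h1, h2⟩ :=
      Fingerprinting.exists_scheme_of_half_lt (n := n) (N := N) hβ hβ' h hδ'
    have hlog : 0 ≤ Real.log (1 / δ) := Real.log_nonneg (by rw [le_div_iff₀ hδ]; linarith)
    exact ⟨0, _, F, by rw [Nat.cast_zero]; positivity, le_rfl,
      Fingerprinting.isFingerprintingCode_and_tracesColluder F hb hd h1 h2⟩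
  · set X := (n : ℝ) ^ 2 * Real.log (1 / δ) / (1 / 2 - β) ^ 4 with hX
    obtain ⟨F, h1, h2⟩ := Fingerprinting.exists_scheme_of_le_half (N := N) (ℓ := ⌈3072 * X⌉₊)
      hn hβ hβ' hδ h (Nat.le_ceil _)
    refine ⟨_, _, F, ?_, le_rfl,
      Fingerprinting.isFingerprintingCode_and_tracesColluder F hb hd h1 h2⟩
    have hn' : (1 : ℝ) ≤ n := by exact_mod_cast hn
    have hlog : 1 / 2 ≤ Real.log (1 / δ) := by
      have h3 : Real.log 2 ≤ Real.log (1 / δ) :=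
        Real.log_le_log two_pos (by rw [le_div_iff₀ hδ]; linarith)
      linarith [Real.log_two_gt_d9]
    -- This lets doubling the constant absorb the rounding: 3072X + 1 ≤ 6144X.
    have hX1 : 1 / 2 ≤ X := by
      rw [hX, le_div_iff₀ (by positivity)]
      have h4 : (1 / 2 - β) ^ 4 ≤ 1 := pow_le_one₀ hγ.le (by linarith)
      have h5 : (1 : ℝ) ≤ (n : ℝ) ^ 2 := one_le_pow₀ hn'
      nlinarith
    have := (Nat.ceil_lt_add_one (show 0 ≤ 3072 * X by linarith)).le
    linarith
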